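/- All graphs are finite and simple. A graph is \emph{biconnected} if it is connected and has no cutvertex (a vertex whose removal disconnects the graph); a \emph{block} of a graph is a maximal biconnected subgraph; a graph is \emph{4-planar} if it is planar and has maximum degree at most $4$. An \emph{orthogonal representation} $\mathcal R$ of a connected 4-planar graph $G=(V,E)$ consists of a combinatorial planar embedding of $G$ with a designated outer face, an integer $\mathrm{rot}(e_f)$ for each incidence of an edge $e$ with a face $f$, and an integer $\mathrm{rot}(v_f)\in\{1,0,-1\}$ for each incidence (angle) of a vertex $v$ in a face $f$ (where $-2$ is allowed if $\deg v=1$), such that (I) the two rotations of every edge are negatives of each other, (II) the rotations of the edges and vertices along the boundary of a face sum to $4$ for every inner face and to $-4$ for the outer face, and (III) the rotations around every vertex $v$ of positive degree sum to $2(\deg(v)-2)$. (If $G$ has no edge, there is nothing to satisfy.) The number of \emph{bends} of $e$ in $\mathcal R$ is $|\mathrm{rot}(e_f)|$. Given a flexibility function $\mathrm{flex}\colon E\to\mathbb N_0\cup\{\infty\}$, $\mathcal R$ is \emph{valid} if every edge $e$ has at most $\mathrm{flex}(e)$ bends; the flexibility is \emph{positive} if $\mathrm{flex}(e)\ge 1$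 for all $e$. Given cost functions $\mathrm{cost}_e\colon\mathbb N_0\to\mathbb R\cup\{\infty\}$ $(e\in E)$, the cost of $\mathcal R$ is $\sum_{e}\mathrm{cost}_e(\text{number of bends of }e)$, and $\mathcal R$ is \emph{optimal} if it has minimum cost among all orthogonal representations of $G$ (over all planar embeddings and outer faces). The instance is \emph{convex} if every $\mathrm{cost}_e$ is monotone (non-decreasing), the largest $\rho$ with $\mathrm{cost}_e(\rho)=\mathrm{cost}_e(0)$ is at least $1$ (possibly infinite), and $\mathrm{cost}_e$ is convex, i.e. $\mathrm{cost}_e(\rho+1)-\mathrm{cost}_e(\rho)$ is non-decreasing in $\rho$ (equivalently, $2\,\mathrm{cost}_e(\rho+1)\le \mathrm{cost}_e(\rho)+\mathrm{cost}_e(\rho+2)$ for all $\rho$, which is the meaning when the value $\infty$ occurs). \textbf{Corollary.} Let $G$ be a 4-planar graph. \begin{enumerate} \item If $G$ is biconnected, then for every positive flexibility function for which $G$ has a valid orthogonal representation, $G$ has a valid orthogonal representation with at most three bends per edge, except for possibly a single edge on the outer face with four bends. \item If $G$ is biconnected, then for all cost functions forming a convex instance, $G$ has an optimal orthogonal representation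 with at most three bends per edge, except for possibly a single edge on the outer face with four bends. \item If $G$ is connected, then for all cost functions forming a convex instance, $G$ has an optimal orthogonal representation in which each block has at most three bends per edge, except for possibly a single edge of that block with four bends. \end{enumerate} -/

import Mathlib

/-- A vertex whose removal disconnects the graph. -/
def IsCutvertex {V : Type*} (G : SimpleGraph V) (v : V) : Prop :=
  ¬ (G.induce ({v}ᶜ : Set V)).Preconnected

/-- A graph is biconnected if it is connected and has no cutvertex. -/
def IsBiconnected {V : Type*} (G : SimpleGraph V) : Prop :=
  G.Connected ∧ ∀ v, ¬ IsCutvertex G v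

/-- A block of `G` is a maximal biconnected subgraph. -/
def IsBlock {V : Type*} (G : SimpleGraph V) (B : G.Subgraph) : Prop :=
  Maximal (fun H : G.Subgraph => IsBiconnected H.coe) B

/-- Successor of a dart along a facial walk. If `ccw` gives the counter-clockwise cyclic order of
the outgoing darts around every vertex, then `d` is followed by `ccw d.symm` on the boundary of the
face that lies to the right of `d`. -/
def facePerm {V : Type*} {G : SimpleGraph V} (ccw : Equiv.Perm G.Dart) : Equiv.Perm G.Dart :=
  (Function.Involutive.toPerm SimpleGraph.Dart.symm SimpleGraph.Dart.symm_involutive).trans ccw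

/-- A combinatorial planar embedding (with a designated outer face) of a finite connected graph:
a rotation system satisfying Euler's formula, together with one of its faces.

A face is an orbit of `facePerm ccw`: the set of darts that have the face to their right. Thus inner
faces are traversed clockwise and the outer face is traversed counter-clockwise. A connected graph
without edges has one face, whose set of darts is empty. -/
structure PlaneEmbedding {V : Type*} [Fintype V] [DecidableEq V] (G : SimpleGraph V)
    [DecidableRel G.Adj] where
  /-- the next outgoing dart, in counter-clockwise order, around the same vertex -/
  ccw : Equiv.Perm G.Dart
  ccw_fst : ∀ d, (ccw d).fst = d.fst
  ccw_cyclic : ∀ d d' : G.Dart, d.fst = d'.fst → ccw.SameCycle d d'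
  euler : Fintype.card V +
      max 1 (Nat.card (Quotient (Equiv.Perm.SameCycle.setoid (facePerm ccw)))) =
    G.edgeFinset.card + 2
  /-- the darts that have the outer face to their right -/
  outer : Finset G.Dart
  outer_face : ∀ d ∈ outer, ∀ d', d' ∈ outer ↔ (facePerm ccw).SameCycle d d'
  outer_nonempty : Nonempty G.Dart → outer.Nonempty

/-- A (connected) graph is 4-planar if it is planar and has maximum degree at most 4. -/
def IsFourPlanar {V : Type*} [Fintype V] [DecidableEq V] (G : SimpleGraph V)
    [DecidableRel G.Adj] : Prop :=
  Nonempty (PlaneEmbedding G) ∧ ∀ v, G.degree v ≤ 4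

/-- An orthogonal representation of a finite connected graph: a planar embedding and the rotations
of edges and vertices in the incident faces. -/
structure OrthRep {V : Type*} [Fintype V] [DecidableEq V] (G : SimpleGraph V)
    [DecidableRel G.Adj] extends PlaneEmbedding G where
  /-- the number of right bends minus the number of left bends of the edge of `d`, traversed in
  direction `d`: this is the rotation of the edge in the face to the right of `d` -/
  rotEdge : G.Dart → ℤ
  /-- the rotation of the vertex `d.snd` in the face to the right of `d`, at the incidence between
  `d` and its successor on that face -/
  rotVertex : G.Dart → ℤ
  rotVertex_range : ∀ d : G.Dart,
    rotVertex d = 1 ∨ rotVertex d = 0 ∨ rotVertex d = -1 ∨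
      (G.degree d.snd = 1 ∧ rotVertex d = -2)
  rotEdge_symm : ∀ d, rotEdge d.symm = - rotEdge d
  rot_face : ∀ d, ∑ d' with (facePerm ccw).SameCycle d d', (rotEdge d' + rotVertex d') =
    if d ∈ outer then -4 else 4
  rot_around_vertex : ∀ v, G.degree v ≠ 0 →
    ∑ d : G.Dart with d.snd = v, rotVertex d = 2 * ((G.degree v : ℤ) - 2)

section

variable {V : Type*} [Fintype V] [DecidableEq V] {G : SimpleGraph V} [DecidableRel G.Adj]

/-- The number of bends of an edge: the common absolute value of its two rotations. -/
def OrthRep.bends (R : OrthRep G) (e : G.edgeSet) : ℕ :=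
  (Finset.univ.filter fun d : G.Dart => d.edge = e).sup fun d => (R.rotEdge d).natAbs

theorem OrthRep.bends_edge (R : OrthRep G) (d : G.Dart) :
    R.bends ⟨d.edge, d.edge_mem⟩ = (R.rotEdge d).natAbs := by
  apply le_antisymm
  · refine Finset.sup_le fun d' hd' => ?_
    have h : d'.edge = d.edge := by simpa using hd'
    rcases (SimpleGraph.dart_edge_eq_iff d' d).1 h with rfl | rfl
    · exact le_rfl
    · rw [R.rotEdge_symm, Int.natAbs_neg]
  · exact Finset.le_sup (f := fun d => (R.rotEdge d).natAbs) (by simp)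

/-- The edge `e` lies on the boundary of the outer face. -/
def OrthRep.OnOuterFace (R : OrthRep G) (e : G.edgeSet) : Prop :=
  ∃ d ∈ R.outer, d.edge = e

/-- Every edge respects its flexibility. -/
def OrthRep.IsValid (R : OrthRep G) (flex : G.edgeSet → ℕ∞) : Prop :=
  ∀ e, (R.bends e : ℕ∞) ≤ flex e

/-- The total cost of an orthogonal representation. -/
noncomputable def OrthRep.totalCost (R : OrthRep G) (cost : G.edgeSet → ℕ → WithTop ℝ) :
    WithTop ℝ :=
  ∑ e, cost e (R.bends e)

/-- Minimum cost among all orthogonal representations of `G`, over all planar embeddings. -/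
def OrthRep.IsOptimal (R : OrthRep G) (cost : G.edgeSet → ℕ → WithTop ℝ) : Prop :=
  ∀ R' : OrthRep G, R.totalCost cost ≤ R'.totalCost cost

/-- At most three bends per edge, except possibly for a single edge on the outer face that has
four bends. -/
def OrthRep.ThreeBendsExceptOuter (R : OrthRep G) : Prop :=
  (∀ e, R.bends e ≤ 3) ∨
    ∃ e₀, R.OnOuterFace e₀ ∧ R.bends e₀ = 4 ∧ ∀ e, e ≠ e₀ → R.bends e ≤ 3

/-- In every block, at most three bends per edge, except possibly for a single edge of the block
that has four bends. -/
def OrthRep.ThreeBendsPerBlock (R : OrthRep G) : Prop :=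
  ∀ B : G.Subgraph, IsBlock G B →
    (∀ e : G.edgeSet, (e : Sym2 V) ∈ B.edgeSet → R.bends e ≤ 3) ∨
      ∃ e₀ : G.edgeSet, (e₀ : Sym2 V) ∈ B.edgeSet ∧ R.bends e₀ = 4 ∧
        ∀ e : G.edgeSet, (e : Sym2 V) ∈ B.edgeSet → e ≠ e₀ → R.bends e ≤ 3

end

/-- The flexibility defined by a monotone cost function: the largest number of bends that costs as
much as no bend (`⊤` if there is no largest one). -/
noncomputable def costFlexibility (c : ℕ → WithTop ℝ) : ℕ∞ :=
  ⨆ ρ : {ρ : ℕ // c ρ = c 0}, ((ρ : ℕ) : ℕ∞)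

/-- The differences of consecutive values are non-decreasing:
`c (ρ + 1) - c ρ ≤ c (ρ + 2) - c (ρ + 1)`, written without subtraction since values may be `∞`. -/
def IsConvexCost (c : ℕ → WithTop ℝ) : Prop :=
  ∀ ρ, c (ρ + 1) + c (ρ + 1) ≤ c ρ + c (ρ + 2)

/-- Convex instances: every cost function is monotone, has positive flexibility and is convex. -/
def IsConvexInstance {E : Type*} (cost : E → ℕ → WithTop ℝ) : Prop :=
  ∀ e, Monotone (cost e) ∧ 1 ≤ costFlexibility (cost e) ∧ IsConvexCost (cost e)

/-! Rotation can be rerouted through the dual graph: changing the rotations by one along a closed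
dual walk keeps every face sum. A first bend is harmless, both for positive flexibilities and for
costs with `c 1 = c 0`. Hence it suffices to study irreducible representations, in which no edge
with two or more bends can lose one while the others stay within `max 1` of what they had. A descent
(`exists_isIrreducible`) reaches them from any representation.

Let `d₀` have rotation at most `-2` in an irreducible representation. The faces to which rotation
can be rerouted from the left side of `d₀` form a dual connected set `Y` that misses the right side,
and every dart of its cut has rotation at least `1` (`IsIrreducible.exists_isBlocking`). An Euler
count for `Y` bounds the total rotation along its boundary (`cut_inequality`): the excess over one
per cut dart, plus the excess of outside angles at boundary vertices, is at most `4`, and at most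
`-4` if `Y` contains the outer face. So `d₀` has at most five bends, and with four or more the outer
face is outside `Y`.

With four bends only one unit of slack is left, so anything hidden outside `Y` hangs on a single
vertex (`IsBlocking.exists_separation`), which biconnectedness excludes. Then the right side of `d₀`
is the outer face and all other edges there are nearly straight, so the four-bend edge is unique.
Five bends never occur: moving the outer face across the edge turns rotation `-5` into `3`. The same
move turns `-4` into `4`, so it gains nothing there. For a block of a connected graph, intersecting
the blocking sets of two four-bend edges gives a contradiction.

Irreducible representations have finitely many bend vectors, so a cheapest one exists, and it is
optimal. -/

/-! ### Faces, dual connectivity and unit flows in the dual graph. -/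

namespace PlaneEmbedding

variable {V : Type*} [Fintype V] [DecidableEq V] {G : SimpleGraph V} [DecidableRel G.Adj]

/-- The faces of an embedding (there is none if the graph has no edges). -/
def Face (P : PlaneEmbedding G) : Type _ :=
  Quotient (Equiv.Perm.SameCycle.setoid (facePerm P.ccw))

/-- The face to the right of a dart. -/
def face (P : PlaneEmbedding G) (d : G.Dart) : P.Face :=
  Quotient.mk _ d

noncomputable instance (P : PlaneEmbedding G) : Fintype P.Face :=
  @Fintype.ofFinite _ (inferInstanceAs (Finite (Quotient _)))

noncomputable instance (P : PlaneEmbedding G) : DecidableEq P.Face :=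
  Classical.decEq _

variable (P : PlaneEmbedding G)

theorem face_eq_iff {d d' : G.Dart} :
    P.face d = P.face d' ↔ (facePerm P.ccw).SameCycle d d' :=
  Quotient.eq (r := Equiv.Perm.SameCycle.setoid (facePerm P.ccw))

theorem exists_face_eq (q : P.Face) : ∃ d, P.face d = q :=
  Quotient.exists_rep q

theorem facePerm_apply (d : G.Dart) : facePerm P.ccw d = P.ccw d.symm := rfl

@[simp]
theorem face_facePerm (d : G.Dart) : P.face (facePerm P.ccw d) = P.face d :=
  P.face_eq_iff.2 ((Equiv.Perm.sameCycle_apply_left).2 (Equiv.Perm.SameCycle.refl _ _))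

@[simp]
theorem facePerm_fst (d : G.Dart) : (facePerm P.ccw d).fst = d.snd := by
  rw [facePerm_apply, P.ccw_fst]; rfl

theorem face_ccw (d : G.Dart) : P.face (P.ccw d) = P.face d.symm := by
  rw [← P.face_facePerm d.symm, facePerm_apply, SimpleGraph.Dart.symm_symm]

/-- The predecessor of `d` on its face ends where `d` starts. -/
theorem exists_pred (d : G.Dart) : ∃ d' : G.Dart, d'.snd = d.fst ∧ P.face d' = P.face d ∧
    facePerm P.ccw d' = d := by
  refine ⟨(facePerm P.ccw).symm d, ?_, ?_, by simp⟩
  · rw [← P.facePerm_fst, Equiv.apply_symm_apply]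
  · rw [← P.face_facePerm, Equiv.apply_symm_apply]

theorem face_induction {x : G.Dart} {p : G.Dart → Prop} (hx : p x)
    (h : ∀ y, P.face y = P.face x → p y → p (facePerm P.ccw y)) {y : G.Dart}
    (hy : P.face y = P.face x) : p y := by
  obtain ⟨n, -, rfl⟩ := (P.face_eq_iff.1 hy.symm).exists_pow_eq'
  clear hy
  have : ∀ n : ℕ, P.face ((facePerm P.ccw ^ n) x) = P.face x ∧ p ((facePerm P.ccw ^ n) x) := by
    intro n
    induction n with
    | zero => exact ⟨rfl, hx⟩
    | succ n ih =>
      rw [pow_succ', Equiv.Perm.mul_apply]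
      exact ⟨(P.face_facePerm _).trans ih.1, h _ ih.1 ih.2⟩
  exact (this n).2

/-- If a property of the darts leaving a vertex holds for some but not all of them, then it changes
somewhere in the cyclic order. -/
theorem exists_ccw_change {d d' : G.Dart} (h : d.fst = d'.fst) {p : G.Dart → Prop} (hd : p d)
    (hd' : ¬ p d') : ∃ a, a.fst = d.fst ∧ p a ∧ ¬ p (P.ccw a) := by
  by_contra! hc
  obtain ⟨n, -, rfl⟩ := (P.ccw_cyclic d d' h).exists_pow_eq'
  have : ∀ n : ℕ, ((P.ccw ^ n) d).fst = d.fst ∧ p ((P.ccw ^ n) d) := by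
    intro n
    induction n with
    | zero => exact ⟨rfl, hd⟩
    | succ n ih =>
      rw [pow_succ', Equiv.Perm.mul_apply]
      exact ⟨(P.ccw_fst _).trans ih.1, hc _ ih.1 ih.2⟩
  exact hd' (this n).2

/-- All faces of `Y` can be reached from the face `g` inside `Y` by crossing darts of `S`, each
time from the face on the left of the dart to the face on its right. -/
def DualConnected (S : Set G.Dart) (Y : Finset P.Face) (g : P.Face) : Prop :=
  g ∈ Y ∧ ∀ A ⊆ Y, g ∈ A →
    (∀ x ∈ S, P.face x ∈ Y → P.face x.symm ∈ A → P.face x ∈ A) → A = Y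

/-- `Y` is the set of faces reachable from `g` within `W`; the last clause records that the search
cannot continue. -/
theorem exists_dualConnected (S : Set G.Dart) {W : Finset P.Face} {g : P.Face} (hg : g ∈ W) :
    ∃ Y ⊆ W, P.DualConnected S Y g ∧
      ∀ x ∈ S, P.face x ∈ W → P.face x.symm ∈ Y → P.face x ∈ Y := by
  classical
  let r : P.Face → P.Face → Prop := fun q q' =>
    q' ∈ W ∧ ∃ x ∈ S, P.face x.symm = q ∧ P.face x = q'
  have hcl : ∀ x ∈ S, P.face x ∈ W → Relation.ReflTransGen r g (P.face x.symm) →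
      Relation.ReflTransGen r g (P.face x) :=
    fun x hxS hxW hx => hx.tail ⟨hxW, x, hxS, rfl, rfl⟩
  have hsub : ∀ q, Relation.ReflTransGen r g q → q ∈ W := by
    intro q hq
    cases hq with
    | refl => exact hg
    | tail _ h => exact h.1
  refine ⟨Finset.univ.filter (Relation.ReflTransGen r g), ?_, ⟨?_, ?_⟩, ?_⟩
  · intro q hq
    exact hsub q (Finset.mem_filter.1 hq).2
  · simpa using Relation.ReflTransGen.refl
  · intro A hA hgA hAcl
    refine hA.antisymm fun q hq => ?_
    replace hq := (Finset.mem_filter.1 hq).2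
    induction hq with
    | refl => exact hgA
    | tail h h' ih =>
      obtain ⟨-, x, hxS, rfl, rfl⟩ := id h'
      exact hAcl x hxS (by simpa using h.tail h') ih
  · intro x hxS hxW hx
    simp only [Finset.mem_filter, Finset.mem_univ, true_and] at hx ⊢
    exact hcl x hxS hxW hx

variable {P}

theorem DualConnected.mono {S S' : Set G.Dart} (hS : S ⊆ S') {Y : Finset P.Face} {g : P.Face}
    (h : P.DualConnected S Y g) : P.DualConnected S' Y g :=
  ⟨h.1, fun A hA hg hA' => h.2 A hA hg fun x hx => hA' x (hS hx)⟩

/-- A largest `A` with `p A` that contains `g` is closed under crossings, since otherwise one more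
face could be added; hence it is all of `Y`. -/
theorem DualConnected.induction {S : Set G.Dart} {Y : Finset P.Face} {g : P.Face}
    (h : P.DualConnected S Y g) {p : Finset P.Face → Prop} (h0 : p {g})
    (hs : ∀ A ⊆ Y, g ∈ A → p A → ∀ x ∈ S, P.face x ∈ Y → P.face x ∉ A →
      P.face x.symm ∈ A → p (insert (P.face x) A)) : p Y := by
  classical
  have hne : (Y.powerset.filter fun A => g ∈ A ∧ p A).Nonempty :=
    ⟨{g}, by simp [h0, h.1]⟩
  obtain ⟨A, hA, hmax⟩ := Finset.exists_max_image _ Finset.card hne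
  simp only [Finset.mem_filter, Finset.mem_powerset] at hA hmax
  rw [← h.2 A hA.1 hA.2.1]
  · exact hA.2.2
  · intro x hxS hxY hxA
    by_contra hx
    have := hmax (insert (P.face x) A) ⟨Finset.insert_subset hxY hA.1,
      Finset.mem_insert_of_mem hA.2.1, hs A hA.1 hA.2.1 hA.2.2 x hxS hxY hx hxA⟩
    rw [Finset.card_insert_of_notMem hx] at this
    omega

/-- A flow of value one from `h` to `g` across the darts of `S` inside a set of faces. -/
theorem DualConnected.exists_flow {S : Set G.Dart} {Y : Finset P.Face} {g : P.Face}
    (hY : P.DualConnected S Y g) {h : P.Face} (hh : h ∈ Y) :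
    ∃ δ : G.Dart → ℤ, (∀ d, δ d.symm = - δ d) ∧ (∀ d, δ d = -1 ∨ δ d = 0 ∨ δ d = 1) ∧
      (∀ d, δ d = -1 → d ∈ S ∧ P.face d ≠ g) ∧
      ∀ q, ∑ d : G.Dart with P.face d = q, δ d =
        (if q = g then 1 else 0) - if q = h then 1 else 0 := by
  suffices H : ∀ h ∈ Y, ∃ δ : G.Dart → ℤ, (∀ d, δ d.symm = - δ d) ∧
      (∀ d, δ d = -1 ∨ δ d = 0 ∨ δ d = 1) ∧
      (∀ d, δ d = -1 → d ∈ S ∧ P.face d ≠ g) ∧ (∀ d, δ d ≠ 0 → P.face d ∈ Y) ∧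
      ∀ q, ∑ d : G.Dart with P.face d = q, δ d =
        (if q = g then 1 else 0) - if q = h then 1 else 0 by
    obtain ⟨δ, h1, h2, h3, -, h5⟩ := H h hh
    exact ⟨δ, h1, h2, h3, h5⟩
  refine hY.induction (p := fun Y => ∀ h ∈ Y, ∃ δ : G.Dart → ℤ, (∀ d, δ d.symm = - δ d) ∧
      (∀ d, δ d = -1 ∨ δ d = 0 ∨ δ d = 1) ∧
      (∀ d, δ d = -1 → d ∈ S ∧ P.face d ≠ g) ∧ (∀ d, δ d ≠ 0 → P.face d ∈ Y) ∧
      ∀ q, ∑ d : G.Dart with P.face d = q, δ d =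
        (if q = g then 1 else 0) - if q = h then 1 else 0) ?_ ?_
  · intro h hh
    rw [Finset.mem_singleton.1 hh]
    exact ⟨fun _ => 0, by simp, by simp, by simp, by simp, by simp⟩
  · intro A hA hgA ih x hxS hxY hxA hxA' h hh
    rcases Finset.mem_insert.1 hh with rfl | hh
    · obtain ⟨δ, h1, h2, h3, h4, h5⟩ := ih _ hxA'
      have hx0 : δ x = 0 := by
        by_contra h
        exact hxA (h4 x h)
      have hxs : x.symm ≠ x := SimpleGraph.Dart.symm_ne x
      have hx0' : δ x.symm = 0 := by rw [h1, hx0, neg_zero]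
      -- The flow from the face left of `x` is prolonged by one crossing of `x`. The old flow
      -- vanishes on `x` because it is supported on `A`, so values stay in `{-1, 0, 1}`.
      refine ⟨fun d => δ d + ((if d = x.symm then 1 else 0) - if d = x then 1 else 0),
        ?_, ?_, ?_, ?_, ?_⟩
      · intro d
        have e1 : d.symm = x.symm ↔ d = x := SimpleGraph.Dart.symm_involutive.injective.eq_iff
        have e2 : d.symm = x ↔ d = x.symm := SimpleGraph.Dart.symm_involutive.eq_iff
        simp only [h1, e1, e2]
        ring
      · intro d
        by_cases e1 : d = x
        · subst e1
          simp [hx0, hxs.symm]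
        · by_cases e2 : d = x.symm
          · subst e2
            simp [hx0', hxs]
          · simpa [e1, e2] using h2 d
      · intro d hd
        by_cases e1 : d = x
        · subst e1
          exact ⟨hxS, fun h => hxA (h ▸ hgA)⟩
        · by_cases e2 : d = x.symm
          · subst e2
            simp [hx0', hxs] at hd
          · exact h3 d (by simpa [e1, e2] using hd)
      · intro d hd
        by_cases e1 : d = x
        · subst e1
          exact Finset.mem_insert_self _ _
        · by_cases e2 : d = x.symm
          · subst e2
            exact Finset.mem_insert_of_mem hxA'
          · exact Finset.mem_insert_of_mem (h4 d (by simpa [e1, e2] using hd))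
      · intro q
        rw [Finset.sum_add_distrib, h5, Finset.sum_sub_distrib]
        simp only [Finset.sum_ite_eq', Finset.mem_filter, Finset.mem_univ, true_and]
        simp only [eq_comm (b := q)]
        ring
    · obtain ⟨δ, h1, h2, h3, h4, h5⟩ := ih _ hh
      exact ⟨δ, h1, h2, h3, fun d hd => Finset.mem_insert_of_mem (h4 d hd), h5⟩

/-! ### Complementary trees and the Euler inequality of a region. -/

/-- A spanning tree of a dual connected set of faces: its edges can be removed from the graph
without disconnecting it. -/
theorem DualConnected.exists_tree (hG : G.Preconnected) {S : Set G.Dart} {Y : Finset P.Face}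
    {g : P.Face} (h : P.DualConnected S Y g) :
    ∃ T : Finset (Sym2 V), T.card + 1 = Y.card ∧ (T : Set (Sym2 V)) ⊆ G.edgeSet ∧
      (∀ d : G.Dart, d.edge ∈ T → P.face d ∈ Y) ∧
      (G.deleteEdges (T : Set (Sym2 V))).Preconnected := by
  refine h.induction (p := fun Y => ∃ T : Finset (Sym2 V), T.card + 1 = Y.card ∧
    (T : Set (Sym2 V)) ⊆ G.edgeSet ∧ (∀ d : G.Dart, d.edge ∈ T → P.face d ∈ Y) ∧
      (G.deleteEdges (T : Set (Sym2 V))).Preconnected) ⟨∅, by simpa using hG⟩ ?_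
  rintro A - - ⟨T, hcard, hTG, hTA, hT⟩ x - - hxA hxA'
  have hxT : x.edge ∉ T := fun hx => hxA (hTA x hx)
  refine ⟨insert x.edge T, ?_, ?_, ?_, ?_⟩
  · rw [Finset.card_insert_of_notMem hxT, Finset.card_insert_of_notMem hxA, hcard]
  · rw [Finset.coe_insert]
    exact Set.insert_subset x.edge_mem hTG
  · intro d hd
    rcases Finset.mem_insert.1 hd with hd | hd
    · rcases (SimpleGraph.dart_edge_eq_iff d x).1 hd with rfl | rfl
      · exact Finset.mem_insert_self _ _
      · exact Finset.mem_insert_of_mem hxA'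
    · exact Finset.mem_insert_of_mem (hTA d hd)
  · set K := G.deleteEdges (↑(insert x.edge T) : Set (Sym2 V)) with hK
    -- The rest of the boundary of the new face is a detour around the removed edge `x`: tree edges
    -- have both sides in `A`, so none of them lies on this face.
    have key : ∀ y, P.face y = P.face x → K.Reachable x.snd y.snd := by
      intro y hy
      refine P.face_induction (p := fun y => K.Reachable x.snd y.snd)
        (SimpleGraph.Reachable.refl _) ?_ hy
      intro y hy ih
      by_cases hyx : facePerm P.ccw y = x
      · rw [hyx]
      refine ih.trans (SimpleGraph.Adj.reachable ?_)
      have hface : P.face (facePerm P.ccw y) = P.face x := (P.face_facePerm y).trans hy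
      rw [← P.facePerm_fst y, hK, SimpleGraph.deleteEdges_adj]
      refine ⟨(facePerm P.ccw y).adj, fun hmem => ?_⟩
      rcases Finset.mem_insert.1 (Finset.mem_coe.1 hmem) with hmem | hmem
      · rcases (SimpleGraph.dart_edge_eq_iff (facePerm P.ccw y) x).1 hmem with h1 | h1
        · exact hyx h1
        · rw [h1] at hface
          exact hxA (hface ▸ hxA')
      · exact hxA (hface ▸ hTA (facePerm P.ccw y) hmem)
    obtain ⟨z, hz, hzx, -⟩ := P.exists_pred x
    have hx : K.Reachable x.snd x.fst := hz ▸ key z hzx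
    have hadj : ∀ a b, (G.deleteEdges (T : Set (Sym2 V))).Adj a b → K.Reachable a b := by
      intro a b hab
      rw [SimpleGraph.deleteEdges_adj] at hab
      by_cases he : s(a, b) = x.edge
      · rcases (SimpleGraph.dart_edge_eq_iff ⟨(a, b), hab.1⟩ x).1 he with h1 | h1
        · rw [← h1] at hx; exact hx.symm
        · have h2 := congrArg SimpleGraph.Dart.symm h1
          rw [SimpleGraph.Dart.symm_symm] at h2
          rw [← h2] at hx; exact hx
      · refine SimpleGraph.Adj.reachable ?_
        rw [hK, SimpleGraph.deleteEdges_adj]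
        refine ⟨hab.1, fun hmem => ?_⟩
        rcases Finset.mem_insert.1 (Finset.mem_coe.1 hmem) with hmem | hmem
        · exact he hmem
        · exact hab.2 hmem
    intro a b
    obtain ⟨w⟩ := hT a b
    induction w with
    | nil => exact SimpleGraph.Reachable.refl _
    | cons hab _ ih => exact (hadj _ _ hab).trans ih

variable (P)

/-- The vertices all of whose angles are in faces of `Y`. -/
noncomputable def interior (Y : Finset P.Face) : Finset V :=
  Finset.univ.filter fun v => ∀ d : G.Dart, d.snd = v → P.face d ∈ Y

variable {P}

theorem mem_interior {Y : Finset P.Face} {v : V} :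
    v ∈ P.interior Y ↔ ∀ d : G.Dart, d.snd = v → P.face d ∈ Y := by
  simp [interior]

theorem face_mem_of_mem_interior {Y : Finset P.Face} {v : V} (hv : v ∈ P.interior Y)
    {d : G.Dart} (hd : d.fst = v) : P.face d ∈ Y := by
  obtain ⟨z, hz, hzd, -⟩ := P.exists_pred d
  exact hzd ▸ mem_interior.1 hv z (hz.trans hd)

/-- Two disjoint families of edges have both sides in `Y`: the `|Y| - 1` edges of a dual tree, and
one edge from each interior vertex towards the root `r` in the graph without that tree. As `r` is
not interior, every interior vertex has such a parent edge. -/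
theorem DualConnected.two_mul_card_interior_le (hG : G.Preconnected) {S : Set G.Dart}
    {Y : Finset P.Face} {g : P.Face} (h : P.DualConnected S Y g) {r : V} (hr : r ∉ P.interior Y) :
    2 * ((P.interior Y).card + Y.card) ≤
      (Finset.univ.filter fun d : G.Dart => P.face d ∈ Y ∧ P.face d.symm ∈ Y).card + 2 := by
  obtain ⟨T, hcard, hTG, hTY, hT⟩ := h.exists_tree hG
  set K := G.deleteEdges (T : Set (Sym2 V)) with hK
  have hpar : ∀ v, ∃ w, v ≠ r → K.Adj v w ∧ K.dist w r < K.dist v r := by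
    intro v
    by_cases hv : v = r
    · exact ⟨v, fun h => absurd hv h⟩
    obtain ⟨w, hw⟩ := (hT v r).exists_walk_length_eq_dist
    cases w with
    | nil => exact absurd rfl hv
    | cons hadj q =>
      refine ⟨_, fun _ => ⟨hadj, ?_⟩⟩
      have := SimpleGraph.dist_le q
      rw [SimpleGraph.Walk.length_cons] at hw
      omega
  choose par hpar using hpar
  have hne : ∀ v ∈ P.interior Y, v ≠ r := fun v hv h => hr (h ▸ hv)
  set D := Finset.univ.filter fun d : G.Dart => P.face d ∈ Y ∧ P.face d.symm ∈ Y with hD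
  set E := D.image SimpleGraph.Dart.edge with hE
  have hED : D.card = 2 * E.card := by
    rw [Finset.card_eq_sum_card_image SimpleGraph.Dart.edge D, ← hE, mul_comm, ← smul_eq_mul]
    refine Finset.sum_const_nat fun e he => ?_
    obtain ⟨d, hd, rfl⟩ := Finset.mem_image.1 he
    rw [← SimpleGraph.dart_edge_fiber_card G d.edge d.edge_mem]
    congr 1
    ext d'
    simp only [Finset.mem_filter, Finset.mem_univ, true_and, and_iff_right_iff_imp, hD] at hd ⊢
    intro hd'
    rcases (SimpleGraph.dart_edge_eq_iff d' d).1 hd' with rfl | rfl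
    · exact hd
    · simpa using hd.symm
  have hsub : T ∪ (P.interior Y).image (fun v => s(v, par v)) ⊆ E := by
    intro e he
    rcases Finset.mem_union.1 he with he | he
    · induction e with
      | _ a b =>
        have hadj : G.Adj a b := hTG he
        exact Finset.mem_image.2 ⟨⟨(a, b), hadj⟩, by
          simp only [hD, Finset.mem_filter, Finset.mem_univ, true_and]
          exact ⟨hTY _ he, hTY _ (by rw [SimpleGraph.Dart.edge_symm]; exact he)⟩, rfl⟩
    · obtain ⟨v, hv, rfl⟩ := Finset.mem_image.1 he
      have hadj : G.Adj v (par v) :=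
        (SimpleGraph.deleteEdges_adj.1 (hpar v (hne v hv)).1).1
      exact Finset.mem_image.2 ⟨⟨(v, par v), hadj⟩, by
        simp only [hD, Finset.mem_filter, Finset.mem_univ, true_and]
        exact ⟨face_mem_of_mem_interior hv rfl, mem_interior.1 hv _ rfl⟩, rfl⟩
  have hdisj : Disjoint T ((P.interior Y).image (fun v => s(v, par v))) := by
    rw [Finset.disjoint_right]
    intro e he heT
    obtain ⟨v, hv, rfl⟩ := Finset.mem_image.1 he
    exact (SimpleGraph.deleteEdges_adj.1 (hpar v (hne v hv)).1).2 heT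
  have hinj : ((P.interior Y).image (fun v => s(v, par v))).card = (P.interior Y).card := by
    refine Finset.card_image_of_injOn fun v hv w hw hvw => ?_
    rcases Sym2.eq_iff.1 hvw with ⟨h1, -⟩ | ⟨h1, h2⟩
    · exact h1
    · have h3 := (hpar v (hne v hv)).2
      have h4 := (hpar w (hne w hw)).2
      rw [h2] at h3
      rw [← h1] at h4
      omega
  have := Finset.card_le_card hsub
  rw [Finset.card_union_of_disjoint hdisj, hinj] at this
  omega

end PlaneEmbedding

/-! ### Double counting of darts, region boundaries and frontier vertices. -/

section counting

variable {V : Type*} [Fintype V] {G : SimpleGraph V} [DecidableRel G.Adj]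

theorem sum_antisymm_eq_zero (q : G.Dart → Prop) [DecidablePred q] (f : G.Dart → ℤ)
    (hf : ∀ d, f d.symm = - f d) :
    ∑ d : G.Dart with q d ∧ q d.symm, f d = 0 := by
  have h : ∑ d : G.Dart with q d ∧ q d.symm, f d = ∑ d : G.Dart with q d ∧ q d.symm, f d.symm :=
    Finset.sum_nbij' SimpleGraph.Dart.symm SimpleGraph.Dart.symm
      (by simp +contextual) (by simp +contextual) (by simp) (by simp) (by simp)
  simp only [hf, Finset.sum_neg_distrib] at h
  linarith

theorem sum_filter_split (q s : G.Dart → Prop) [DecidablePred q] [DecidablePred s]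
    (f : G.Dart → ℤ) :
    ∑ d : G.Dart with q d, f d =
      ∑ d : G.Dart with q d ∧ s d, f d + ∑ d : G.Dart with q d ∧ ¬ s d, f d := by
  rw [← Finset.sum_filter_add_sum_filter_not (Finset.univ.filter q) s, Finset.filter_filter,
    Finset.filter_filter]

variable [DecidableEq V]

theorem sum_darts_at_vertices (q : G.Dart → Prop) [DecidablePred q] (f : G.Dart → ℤ) :
    ∑ v, ∑ d : G.Dart with d.snd = v ∧ q d, f d = ∑ d : G.Dart with q d, f d := by
  rw [← Finset.sum_fiberwise_of_maps_to (s := Finset.univ.filter q) (t := Finset.univ)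
    (g := fun d : G.Dart => d.snd) (fun _ _ => Finset.mem_univ _)]
  refine Finset.sum_congr rfl fun v _ => ?_
  rw [Finset.filter_filter]
  refine Finset.sum_congr ?_ fun _ _ => rfl
  ext d
  simp [and_comm]

theorem sum_card_darts_at_vertices (q : G.Dart → Prop) [DecidablePred q] :
    ∑ v, ((Finset.univ.filter fun d : G.Dart => d.snd = v ∧ q d).card : ℤ) =
      (Finset.univ.filter q).card := by
  simpa using sum_darts_at_vertices q (fun _ => (1 : ℤ))

theorem card_darts_snd (v : V) :
    (Finset.univ.filter fun d : G.Dart => d.snd = v).card = G.degree v := by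
  rw [← G.dart_fst_fiber_card_eq_degree v]
  refine Finset.card_bij (fun d _ => d.symm) ?_ ?_ ?_
  · intro d hd
    simpa using hd
  · intro a _ b _ h
    exact SimpleGraph.Dart.symm_involutive.injective h
  · intro b hb
    exact ⟨b.symm, by simpa using hb, by simp⟩

end counting

namespace PlaneEmbedding

variable {V : Type*} [Fintype V] [DecidableEq V] {G : SimpleGraph V} [DecidableRel G.Adj]
variable (P : PlaneEmbedding G)

theorem sum_faces (Y : Finset P.Face) (f : G.Dart → ℤ) :
    ∑ q ∈ Y, ∑ d : G.Dart with P.face d = q, f d = ∑ d : G.Dart with P.face d ∈ Y, f d := by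
  rw [← Finset.sum_fiberwise_of_maps_to (s := Finset.univ.filter fun d => P.face d ∈ Y) (t := Y)
    (g := P.face) (by simp)]
  refine Finset.sum_congr rfl fun q hq => ?_
  rw [Finset.filter_filter]
  refine Finset.sum_congr ?_ fun _ _ => rfl
  ext d
  simp only [Finset.mem_filter, Finset.mem_univ, true_and]
  exact ⟨fun h => ⟨h ▸ hq, h⟩, fun h => h.2⟩

/-- The face `q` is the outer face. -/
def IsOuterFace (q : P.Face) : Prop := ∃ d ∈ P.outer, P.face d = q

theorem mem_outer_iff (d : G.Dart) : d ∈ P.outer ↔ P.IsOuterFace (P.face d) := by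
  refine ⟨fun h => ⟨d, h, rfl⟩, ?_⟩
  rintro ⟨d', hd', h⟩
  exact (P.outer_face d' hd' d).2 (P.face_eq_iff.1 h)

theorem IsOuterFace.eq {P : PlaneEmbedding G} {q q' : P.Face} (h : P.IsOuterFace q)
    (h' : P.IsOuterFace q') : q = q' := by
  obtain ⟨d, hd, rfl⟩ := h
  obtain ⟨d', hd', rfl⟩ := h'
  exact P.face_eq_iff.2 ((P.outer_face d hd d').1 hd')

open Classical in
theorem sum_faceRotation (Y : Finset P.Face) :
    ∑ q ∈ Y, (if P.IsOuterFace q then (-4 : ℤ) else 4) =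
      4 * Y.card - if ∃ q ∈ Y, P.IsOuterFace q then 8 else 0 := by
  split_ifs with h
  · obtain ⟨q, hq, ho⟩ := h
    rw [← Finset.sum_erase_add _ _ hq, if_pos ho, Finset.sum_congr rfl (g := fun _ => (4 : ℤ))]
    · rw [Finset.sum_const, Finset.card_erase_of_mem hq]
      have := Finset.card_pos.2 ⟨q, hq⟩
      simp only [nsmul_eq_mul]
      push_cast [Nat.cast_sub this]
      ring
    · intro q' hq'
      rw [if_neg]
      exact fun h' => (Finset.mem_erase.1 hq').1 (h'.eq ho)
  · rw [Finset.sum_congr rfl (g := fun _ => (4 : ℤ))]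
    · simp [mul_comm]
    · intro q hq
      rw [if_neg fun h' => h ⟨q, hq, h'⟩]

/-- The darts that have a face of `Y` to their right but not to their left. -/
noncomputable def cut (Y : Finset P.Face) : Finset G.Dart :=
  Finset.univ.filter fun d => P.face d ∈ Y ∧ P.face d.symm ∉ Y

/-- The number of angles at `v` outside of `Y`. -/
noncomputable def outAngles (Y : Finset P.Face) (v : V) : ℕ :=
  (Finset.univ.filter fun d : G.Dart => d.snd = v ∧ P.face d ∉ Y).card

/-- The vertices with an angle in `Y` and an angle outside of `Y`. -/
noncomputable def frontier (Y : Finset P.Face) : Finset V :=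
  Finset.univ.filter fun v =>
    (∃ d : G.Dart, d.snd = v ∧ P.face d ∈ Y) ∧ ∃ d : G.Dart, d.snd = v ∧ P.face d ∉ Y

variable {P} {Y : Finset P.Face}

theorem mem_cut {d : G.Dart} : d ∈ P.cut Y ↔ P.face d ∈ Y ∧ P.face d.symm ∉ Y := by
  simp [cut]

theorem mem_frontier {v : V} : v ∈ P.frontier Y ↔
    (∃ d : G.Dart, d.snd = v ∧ P.face d ∈ Y) ∧ ∃ d : G.Dart, d.snd = v ∧ P.face d ∉ Y := by
  simp [frontier]

theorem outAngles_pos {v : V} (hv : v ∈ P.frontier Y) : 1 ≤ P.outAngles Y v := by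
  obtain ⟨d, hd, hdY⟩ := (mem_frontier.1 hv).2
  exact Finset.card_pos.2 ⟨d, by simp [hd, hdY]⟩

/-- Around `v` the angles switch from inside to outside of `Y` and back, and each switch happens
across a cut edge. -/
theorem exists_cut_of_mem_frontier {v : V} (hv : v ∈ P.frontier Y) :
    (∃ d : G.Dart, d.snd = v ∧ P.face d ∈ Y ∧ P.face d.symm ∉ Y) ∧
      ∃ d : G.Dart, d.snd = v ∧ P.face d ∉ Y ∧ P.face d.symm ∈ Y := by
  obtain ⟨⟨d, hd, hdY⟩, d', hd', hdY'⟩ := mem_frontier.1 hv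
  constructor
  · obtain ⟨a, ha, h1, h2⟩ := P.exists_ccw_change (d := d'.symm) (d' := d.symm)
      (p := fun a => P.face a.symm ∉ Y) (hd'.trans hd.symm) (by simpa using hdY')
      (by simpa using hdY)
    refine ⟨(P.ccw a).symm, ?_, not_not.1 h2, ?_⟩
    · exact (P.ccw_fst a).trans (ha.trans hd')
    · rwa [SimpleGraph.Dart.symm_symm, P.face_ccw]
  · obtain ⟨a, ha, h1, h2⟩ := P.exists_ccw_change (d := d.symm) (d' := d'.symm)
      (p := fun a => P.face a.symm ∈ Y) (hd.trans hd'.symm) (by simpa using hdY)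
      (by simpa using hdY')
    refine ⟨(P.ccw a).symm, ?_, h2, ?_⟩
    · exact (P.ccw_fst a).trans (ha.trans hd)
    · rwa [SimpleGraph.Dart.symm_symm, P.face_ccw]

end PlaneEmbedding

/-! ### Total rotation along the boundary of a region. -/

namespace OrthRep

variable {V : Type*} [Fintype V] [DecidableEq V] {G : SimpleGraph V} [DecidableRel G.Adj]
variable (R : OrthRep G) {Y : Finset R.Face}

theorem rotVertex_le_one (d : G.Dart) : R.rotVertex d ≤ 1 := by
  rcases R.rotVertex_range d with h | h | h | ⟨-, h⟩ <;> omega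

open Classical in
theorem sum_face (q : R.Face) :
    ∑ d : G.Dart with R.face d = q, (R.rotEdge d + R.rotVertex d) =
      if R.IsOuterFace q then -4 else 4 := by
  obtain ⟨d, rfl⟩ := R.exists_face_eq q
  have h := R.rot_face d
  simp only [R.mem_outer_iff] at h
  rw [← h]
  refine Finset.sum_congr ?_ fun _ _ => rfl
  ext d'
  simp only [Finset.mem_filter, Finset.mem_univ, true_and, ← R.face_eq_iff]
  exact eq_comm

open Classical in
theorem sum_mem_faces (Y : Finset R.Face) :
    ∑ d : G.Dart with R.face d ∈ Y, (R.rotEdge d + R.rotVertex d) =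
      4 * Y.card - if ∃ q ∈ Y, R.IsOuterFace q then 8 else 0 := by
  rw [← R.sum_faces, ← R.sum_faceRotation]
  simp only [R.sum_face]

-- At an interior vertex the first two terms match the angle sum exactly. At a frontier vertex with
-- `a` angles inside and `o` outside, the outside angles contribute at most `o`, so twice the inside
-- sum is at least `4a + 2o - 8`; the two kinds of cut darts ending there contribute at least `3 *
-- 2`.
open Classical in
theorem vertex_inequality (Y : Finset R.Face) (v : V) :
    4 * ((Finset.univ.filter fun d : G.Dart => d.snd = v ∧ R.face d ∈ Y).card : ℤ)
      - 8 * (if v ∈ R.interior Y then 1 else 0)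
      + 2 * (if v ∈ R.frontier Y then (R.outAngles Y v : ℤ) - 1 else 0) ≤
    2 * ∑ d : G.Dart with d.snd = v ∧ R.face d ∈ Y, R.rotVertex d
      + 3 * ((Finset.univ.filter fun d : G.Dart =>
          d.snd = v ∧ R.face d ∈ Y ∧ R.face d.symm ∉ Y).card
        + (Finset.univ.filter fun d : G.Dart =>
          d.snd = v ∧ R.face d ∉ Y ∧ R.face d.symm ∈ Y).card : ℤ) := by
  have hsplit := sum_filter_split (fun d : G.Dart => d.snd = v) (fun d => R.face d ∈ Y) R.rotVertex
  have hdeg := Finset.card_filter_add_card_filter_not (s := Finset.univ.filter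
    fun d : G.Dart => d.snd = v) (fun d => R.face d ∈ Y)
  rw [Finset.filter_filter, Finset.filter_filter, card_darts_snd] at hdeg
  have hout : ∑ d : G.Dart with d.snd = v ∧ R.face d ∉ Y, R.rotVertex d ≤ R.outAngles Y v := by
    refine (Finset.sum_le_card_nsmul _ _ 1 fun d _ => R.rotVertex_le_one d).trans ?_
    simp [PlaneEmbedding.outAngles]
  change (_ : ℕ) + R.outAngles Y v = _ at hdeg
  by_cases hint : v ∈ R.interior Y
  · have hfr : v ∉ R.frontier Y := by
      rw [PlaneEmbedding.mem_frontier]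
      rintro ⟨-, d, hd, hdY⟩
      exact hdY (PlaneEmbedding.mem_interior.1 hint d hd)
    have h0 : (Finset.univ.filter fun d : G.Dart => d.snd = v ∧ R.face d ∉ Y) = ∅ := by
      rw [Finset.filter_eq_empty_iff]
      rintro d - ⟨hd, hdY⟩
      exact hdY (PlaneEmbedding.mem_interior.1 hint d hd)
    rw [if_pos hint, if_neg hfr]
    rw [PlaneEmbedding.outAngles, h0, Finset.card_empty] at hdeg
    rw [h0, Finset.sum_empty] at hsplit
    by_cases hv : G.degree v = 0
    · have h1 : (Finset.univ.filter fun d : G.Dart => d.snd = v ∧ R.face d ∈ Y) = ∅ := by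
        rw [← Finset.card_eq_zero]; omega
      rw [h1, Finset.card_empty, Finset.sum_empty]
      omega
    · have h2 := R.rot_around_vertex v hv
      omega
  · rw [if_neg hint]
    rw [PlaneEmbedding.mem_interior] at hint
    push Not at hint
    obtain ⟨d, hd, hdY⟩ := hint
    by_cases hfr : v ∈ R.frontier Y
    · rw [if_pos hfr]
      have hv : G.degree v ≠ 0 := by
        have := PlaneEmbedding.outAngles_pos hfr
        omega
      have h2 := R.rot_around_vertex v hv
      obtain ⟨⟨x, hx⟩, y, hy⟩ := PlaneEmbedding.exists_cut_of_mem_frontier hfr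
      have hx' : 0 < (Finset.univ.filter fun d : G.Dart =>
          d.snd = v ∧ R.face d ∈ Y ∧ R.face d.symm ∉ Y).card :=
        Finset.card_pos.2 ⟨x, Finset.mem_filter.2 ⟨Finset.mem_univ _, hx⟩⟩
      have hy' : 0 < (Finset.univ.filter fun d : G.Dart =>
          d.snd = v ∧ R.face d ∉ Y ∧ R.face d.symm ∈ Y).card :=
        Finset.card_pos.2 ⟨y, Finset.mem_filter.2 ⟨Finset.mem_univ _, hy⟩⟩
      omega
    · have h1 : (Finset.univ.filter fun d : G.Dart => d.snd = v ∧ R.face d ∈ Y) = ∅ := by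
        rw [Finset.filter_eq_empty_iff]
        rintro d' - ⟨hd', hdY'⟩
        exact hfr (PlaneEmbedding.mem_frontier.2 ⟨⟨d', hd', hdY'⟩, d, hd, hdY⟩)
      rw [h1, if_neg hfr, Finset.card_empty, Finset.sum_empty]
      omega

open Classical in
/-- The rotations of the edges along the boundary of a dual connected set of faces. -/
theorem cut_inequality (hG : G.Preconnected) {S : Set G.Dart} {g : R.Face}
    (hY : R.DualConnected S Y g) {x : G.Dart} (hx : R.face x ∉ Y) :
    ∑ d ∈ R.cut Y, (R.rotEdge d - 1) + ∑ v ∈ R.frontier Y, ((R.outAngles Y v : ℤ) - 1) ≤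
      4 - if ∃ q ∈ Y, R.IsOuterFace q then 8 else 0 := by
  have htree := hY.two_mul_card_interior_le hG (r := x.snd)
    (fun h => hx (PlaneEmbedding.mem_interior.1 h x rfl))
  have hsum := R.sum_mem_faces Y
  rw [Finset.sum_add_distrib] at hsum
  have hedge := sum_filter_split (fun d => R.face d ∈ Y) (fun d => R.face d.symm ∈ Y) R.rotEdge
  rw [sum_antisymm_eq_zero (fun d => R.face d ∈ Y) R.rotEdge R.rotEdge_symm, zero_add] at hedge
  have hcard := Finset.card_filter_add_card_filter_not (s := Finset.univ.filter
    fun d : G.Dart => R.face d ∈ Y) (fun d => R.face d.symm ∈ Y)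
  rw [Finset.filter_filter, Finset.filter_filter] at hcard
  -- Summed over all vertices, each cut edge is counted once in each direction, hence six times in
  -- total.
  have hvert := Finset.sum_le_sum fun v (_ : v ∈ Finset.univ) => R.vertex_inequality Y v
  simp only [Finset.sum_add_distrib, Finset.sum_sub_distrib, ← Finset.mul_sum,
    sum_darts_at_vertices (fun d => R.face d ∈ Y),
    sum_card_darts_at_vertices (fun d => R.face d ∈ Y),
    sum_card_darts_at_vertices (fun d => R.face d ∈ Y ∧ R.face d.symm ∉ Y),
    sum_card_darts_at_vertices (fun d => R.face d ∉ Y ∧ R.face d.symm ∈ Y)] at hvert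
  have hsymm : (Finset.univ.filter fun d => R.face d ∉ Y ∧ R.face d.symm ∈ Y).card =
      (Finset.univ.filter fun d => R.face d ∈ Y ∧ R.face d.symm ∉ Y).card :=
    Finset.card_nbij' SimpleGraph.Dart.symm SimpleGraph.Dart.symm
      (by simp +contextual [Set.MapsTo]) (by simp +contextual [Set.MapsTo])
      (by simp [Set.LeftInvOn]) (by simp [Set.LeftInvOn])
  have hint : ∑ v, (if v ∈ R.interior Y then (1 : ℤ) else 0) = (R.interior Y).card := by
    simp
  have hfr : ∑ v, (if v ∈ R.frontier Y then (R.outAngles Y v : ℤ) - 1 else 0) =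
      ∑ v ∈ R.frontier Y, ((R.outAngles Y v : ℤ) - 1) := by
    simp
  have hc : ∑ d ∈ R.cut Y, (R.rotEdge d - 1) =
      ∑ d : G.Dart with R.face d ∈ Y ∧ R.face d.symm ∉ Y, R.rotEdge d
        - (Finset.univ.filter fun d => R.face d ∈ Y ∧ R.face d.symm ∉ Y).card := by
    rw [PlaneEmbedding.cut, Finset.sum_sub_distrib]
    simp
  rw [hint, hfr] at hvert
  rw [hc]
  omega

end OrthRep

/-! ### Irreducible representations and blocking sets. -/

namespace OrthRep

variable {V : Type*} [Fintype V] [DecidableEq V] {G : SimpleGraph V} [DecidableRel G.Adj]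

/-- Exchange the rotations of the edges, keeping the total rotation of the edges of every face. -/
def withRotEdge (R : OrthRep G) (ρ : G.Dart → ℤ) (hρ : ∀ d, ρ d.symm = - ρ d)
    (hf : ∀ q : R.Face,
      ∑ d : G.Dart with R.face d = q, ρ d = ∑ d : G.Dart with R.face d = q, R.rotEdge d) :
    OrthRep G :=
  { R with
    rotEdge := ρ
    rotEdge_symm := hρ
    rot_face := by
      intro d
      rw [← R.rot_face d, Finset.sum_add_distrib, Finset.sum_add_distrib]
      congr 1
      convert hf (R.face d) using 2 <;>
      · ext d'
        simp only [Finset.mem_filter, Finset.mem_univ, true_and, ← R.face_eq_iff]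
        exact eq_comm }

/-- `R'` has at most one bend on edges without bends in `R`, no more bends than `R` on the other
edges, and fewer bends than `R` on some edge with two bends or more. -/
def IsImprovedBy (R R' : OrthRep G) : Prop :=
  (∀ d, (R'.rotEdge d).natAbs ≤ max 1 (R.rotEdge d).natAbs) ∧
    ∃ d, 2 ≤ (R.rotEdge d).natAbs ∧ (R'.rotEdge d).natAbs < (R.rotEdge d).natAbs

/-- No representation improves `R`. -/
def IsIrreducible (R : OrthRep G) : Prop := ∀ R', ¬ R.IsImprovedBy R'

variable {R : OrthRep G}

/-- `Y` separates the face to the right of `d` from the face to the left, and rotation can only be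
transferred out of `Y`. -/
structure IsBlocking (R : OrthRep G) (Y : Finset R.Face) (d : G.Dart) : Prop where
  dualConnected : R.DualConnected Set.univ Y (R.face d.symm)
  notMem : R.face d ∉ Y
  one_le : ∀ y ∈ R.cut Y, 1 ≤ R.rotEdge y

/-- `Y` consists of the faces reachable from the left of `d₀` by crossing darts of nonnegative
rotation. Such a crossing lowers a rotation to no less than `-1`. If the right of `d₀` were
reachable, closing the walk through `d₀` would remove one of its bends. -/
theorem IsIrreducible.exists_isBlocking (hR : R.IsIrreducible) {d₀ : G.Dart}
    (hd₀ : R.rotEdge d₀ ≤ -2) : ∃ Y, R.IsBlocking Y d₀ := by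
  obtain ⟨Y, -, hY, hcl⟩ := R.exists_dualConnected {x | 0 ≤ R.rotEdge x}
    (Finset.mem_univ (R.face d₀.symm))
  refine ⟨Y, hY.mono (Set.subset_univ _), fun hmem => ?_, ?_⟩
  · obtain ⟨δ, h1, h2, h3, h4⟩ := hY.exists_flow hmem
    have hne : d₀.symm ≠ d₀ := SimpleGraph.Dart.symm_ne d₀
    -- The flow never enters its end face `g`, and `d₀` itself is not in `S`; so it leaves the edge
    -- of `d₀` alone.
    have h0' : δ d₀.symm ≠ -1 := fun h => (h3 _ h).2 rfl
    have h0 : δ d₀ = 0 := by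
      rcases h2 d₀ with h | h | h
      · have := (h3 _ h).1
        simp only [Set.mem_ofPred_eq] at this
        omega
      · exact h
      · exact absurd (by rw [h1, h]) h0'
    have hs : ∀ d, (if d.symm = d₀ then (1 : ℤ) else 0) = if d = d₀.symm then 1 else 0 := by
      intro d
      simp only [SimpleGraph.Dart.symm_involutive.eq_iff]
    have hs' : ∀ d, (if d.symm = d₀.symm then (1 : ℤ) else 0) = if d = d₀ then 1 else 0 := by
      intro d
      simp only [SimpleGraph.Dart.symm_involutive.injective.eq_iff]
    refine hR (R.withRotEdge (fun d => R.rotEdge d + δ d +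
      ((if d = d₀ then 1 else 0) - if d = d₀.symm then 1 else 0)) ?_ ?_) ⟨?_, d₀, by omega, ?_⟩
    · intro d
      simp only [hs, hs', h1, R.rotEdge_symm]
      ring
    · intro q
      rw [Finset.sum_add_distrib, Finset.sum_add_distrib, h4, Finset.sum_sub_distrib]
      simp only [Finset.sum_ite_eq', Finset.mem_filter, Finset.mem_univ, true_and]
      simp only [eq_comm (b := q)]
      ring
    · intro d
      simp only [withRotEdge]
      by_cases e1 : d = d₀
      · subst e1
        simp only [h0, if_true, if_neg hne.symm]
        omega
      · by_cases e2 : d = d₀.symm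
        · subst e2
          simp only [h1, h0, if_true, if_neg hne, R.rotEdge_symm]
          omega
        · simp only [if_neg e1, if_neg e2]
          rcases h2 d with h | h | h
          · have := (h3 _ h).1
            simp only [Set.mem_ofPred_eq] at this
            omega
          · omega
          · have := (h3 d.symm (by rw [h1, h])).1
            simp only [Set.mem_ofPred_eq, R.rotEdge_symm] at this
            omega
    · simp only [withRotEdge, h0, if_true, if_neg hne.symm]
      omega
  · intro y hy
    obtain ⟨h1, h2⟩ := PlaneEmbedding.mem_cut.1 hy
    by_contra h
    refine h2 (hcl y.symm ?_ (Finset.mem_univ _) (by simpa using h1))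
    simp only [Set.mem_ofPred_eq, R.rotEdge_symm]
    omega

namespace IsBlocking

variable {Y : Finset R.Face} {d₀ : G.Dart}

theorem symm_mem_cut (h : R.IsBlocking Y d₀) : d₀.symm ∈ R.cut Y :=
  PlaneEmbedding.mem_cut.2 ⟨h.dualConnected.1, by simpa using h.notMem⟩

theorem fst_mem_frontier (h : R.IsBlocking Y d₀) : d₀.fst ∈ R.frontier Y := by
  refine PlaneEmbedding.mem_frontier.2 ⟨⟨d₀.symm, rfl, h.dualConnected.1⟩, ?_⟩
  obtain ⟨z, hz, hz', -⟩ := R.exists_pred d₀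
  exact ⟨z, hz, hz' ▸ h.notMem⟩

theorem snd_mem_frontier (h : R.IsBlocking Y d₀) : d₀.snd ∈ R.frontier Y := by
  refine PlaneEmbedding.mem_frontier.2 ⟨?_, d₀, rfl, h.notMem⟩
  obtain ⟨z, hz, hz', -⟩ := R.exists_pred d₀.symm
  exact ⟨z, hz, hz' ▸ h.dualConnected.1⟩

-- The dart `d₀.symm` is in the cut and has rotation `-R.rotEdge d₀`. All other summands are
-- nonnegative, so many bends on `d₀` leave little room for them.
open Classical in
theorem sum_le (h : R.IsBlocking Y d₀) (hG : G.Preconnected) :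
    -R.rotEdge d₀ - 1 + ∑ d ∈ (R.cut Y).erase d₀.symm, (R.rotEdge d - 1)
      + ∑ v ∈ R.frontier Y, ((R.outAngles Y v : ℤ) - 1) ≤
      4 - if ∃ q ∈ Y, R.IsOuterFace q then 8 else 0 := by
  have := R.cut_inequality hG h.dualConnected h.notMem
  rwa [← Finset.add_sum_erase _ _ h.symm_mem_cut, R.rotEdge_symm] at this

theorem sum_cut_nonneg (h : R.IsBlocking Y d₀) :
    ∀ d ∈ (R.cut Y).erase d₀.symm, 0 ≤ R.rotEdge d - 1 :=
  fun d hd => by linarith [h.one_le d (Finset.mem_of_mem_erase hd)]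

theorem sum_frontier_nonneg : ∀ v ∈ R.frontier Y, 0 ≤ (R.outAngles Y v : ℤ) - 1 :=
  fun v hv => by
    have := PlaneEmbedding.outAngles_pos hv
    omega

theorem not_isOuterFace (h : R.IsBlocking Y d₀) (hG : G.Preconnected)
    (hd₀ : R.rotEdge d₀ ≤ -4) {q : R.Face} (hq : q ∈ Y) : ¬ R.IsOuterFace q := by
  intro ho
  have h1 := h.sum_le hG
  have h2 := Finset.sum_nonneg h.sum_cut_nonneg
  have h3 := Finset.sum_nonneg (sum_frontier_nonneg (R := R) (Y := Y))
  rw [if_pos ⟨q, hq, ho⟩] at h1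
  linarith

theorem sum_le' (h : R.IsBlocking Y d₀) (hG : G.Preconnected) (hd₀ : R.rotEdge d₀ ≤ -4) :
    -R.rotEdge d₀ + ∑ d ∈ (R.cut Y).erase d₀.symm, (R.rotEdge d - 1)
      + ∑ v ∈ R.frontier Y, ((R.outAngles Y v : ℤ) - 1) ≤ 5 := by
  have h1 := h.sum_le hG
  rw [if_neg] at h1
  · linarith
  · rintro ⟨q, hq, ho⟩
    exact h.not_isOuterFace hG hd₀ hq ho

theorem neg_five_le (h : R.IsBlocking Y d₀) (hG : G.Preconnected) (hd₀ : R.rotEdge d₀ ≤ -4) :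
    -5 ≤ R.rotEdge d₀ := by
  have h1 := h.sum_le' hG hd₀
  have h2 := Finset.sum_nonneg h.sum_cut_nonneg
  have h3 := Finset.sum_nonneg (sum_frontier_nonneg (R := R) (Y := Y))
  linarith

theorem le_two (h : R.IsBlocking Y d₀) (hG : G.Preconnected) (hd₀ : R.rotEdge d₀ ≤ -4)
    {y : G.Dart} (hy : y ∈ R.cut Y) (hne : y ≠ d₀.symm) : R.rotEdge y ≤ 2 := by
  have h1 := h.sum_le' hG hd₀
  have h2 := Finset.single_le_sum h.sum_cut_nonneg (Finset.mem_erase.2 ⟨hne, hy⟩)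
  have h3 := Finset.sum_nonneg (sum_frontier_nonneg (R := R) (Y := Y))
  linarith

theorem outAngles_le (h : R.IsBlocking Y d₀) (hG : G.Preconnected) (hd₀ : R.rotEdge d₀ ≤ -4)
    {v : V} (hv : v ∈ R.frontier Y) : (R.outAngles Y v : ℤ) ≤ 6 + R.rotEdge d₀ := by
  have h1 := h.sum_le' hG hd₀
  have h2 := Finset.sum_nonneg h.sum_cut_nonneg
  have h3 := Finset.single_le_sum (sum_frontier_nonneg (R := R) (Y := Y)) hv
  linarith

theorem eq_of_outAngles (h : R.IsBlocking Y d₀) (hG : G.Preconnected)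
    (hd₀ : R.rotEdge d₀ ≤ -4) {v w : V} (hv : v ∈ R.frontier Y) (hw : w ∈ R.frontier Y)
    (hv2 : 2 ≤ R.outAngles Y v) (hw2 : 2 ≤ R.outAngles Y w) : v = w := by
  by_contra hne
  have h1 := h.sum_le' hG hd₀
  have h2 := Finset.sum_nonneg h.sum_cut_nonneg
  rw [← Finset.add_sum_erase _ _ hv] at h1
  have h3 := Finset.single_le_sum (s := (R.frontier Y).erase v)
    (f := fun v => (R.outAngles Y v : ℤ) - 1)
    (fun u hu => sum_frontier_nonneg u (Finset.mem_of_mem_erase hu))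
    (Finset.mem_erase.2 ⟨Ne.symm hne, hw⟩)
  omega

/-- An end of an edge with no side in `Y` either has all its angles outside of `Y` or at least two
of them. -/
theorem two_le_outAngles {x : G.Dart} (hx : R.face x ∉ Y) (hx' : R.face x.symm ∉ Y)
    (hfr : x.snd ∈ R.frontier Y) : 2 ≤ R.outAngles Y x.snd := by
  obtain ⟨z, hz, hzf, hzx⟩ := R.exists_pred x.symm
  -- Equality would mean that `x.snd` has degree one, so its only angle would be outside of `Y`.
  have hne : z ≠ x := by
    rintro rfl
    obtain ⟨⟨d, hd, hdY⟩, -⟩ := PlaneEmbedding.mem_frontier.1 hfr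
    rw [R.facePerm_apply] at hzx
    have h1 : z.symm = d.symm :=
      (R.ccw_cyclic z.symm d.symm hd.symm).eq_of_left hzx
    exact hx (SimpleGraph.Dart.symm_involutive.injective h1 ▸ hdY)
  refine Finset.one_lt_card.2 ⟨z, ?_, x, ?_, hne⟩
  · simp only [Finset.mem_filter, Finset.mem_univ, true_and]
    exact ⟨hz, hzf ▸ hx'⟩
  · simpa using hx

/-- The part of the graph outside of `Y` is attached to the rest at a single vertex. -/
theorem exists_separation (h : R.IsBlocking Y d₀) (hG : G.Preconnected)
    (hd₀ : R.rotEdge d₀ ≤ -4) {x : G.Dart} (hx : R.face x ∉ Y) (hx' : R.face x.symm ∉ Y) :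
    ∃ (A : Set V) (v : V),
      (∀ a ∈ A, ∀ b, G.Adj a b → b ∈ A ∨ b = v ∧ b ∈ R.frontier Y ∧ 2 ≤ R.outAngles Y b) ∧
      (x.fst ∈ A ∨ x.snd ∈ A) ∧ d₀.fst ∉ A ∧ d₀.snd ∉ A := by
  obtain ⟨v, hv⟩ : ∃ v, ∀ w ∈ R.frontier Y, 2 ≤ R.outAngles Y w → w = v := by
    by_cases hex : ∃ v ∈ R.frontier Y, 2 ≤ R.outAngles Y v
    · obtain ⟨v, hv, hv2⟩ := hex
      exact ⟨v, fun w hw hw2 => h.eq_of_outAngles hG hd₀ hw hv hw2 hv2⟩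
    -- Nothing is attached in this case; `d₀.fst` is an arbitrary value.
    · exact ⟨d₀.fst, fun w hw hw2 => absurd ⟨w, hw, hw2⟩ hex⟩
  have hout : ∀ y : G.Dart, R.face y ∉ Y → R.face y.symm ∉ Y →
      y.snd ∈ {v | ∀ d : G.Dart, d.snd = v → R.face d ∉ Y} ∨
        y.snd = v ∧ y.snd ∈ R.frontier Y ∧ 2 ≤ R.outAngles Y y.snd := by
    intro y hy hy'
    by_cases hfr : y.snd ∈ R.frontier Y
    · have := two_le_outAngles hy hy' hfr
      exact Or.inr ⟨hv _ hfr this, hfr, this⟩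
    · left
      intro d hd hdY
      exact hfr (PlaneEmbedding.mem_frontier.2 ⟨⟨d, hd, hdY⟩, y, rfl, hy⟩)
  -- An edge leaving this set has both sides outside of `Y` and ends on the frontier, where the
  -- slack allows only `v`.
  refine ⟨{v | ∀ d : G.Dart, d.snd = v → R.face d ∉ Y}, v, ?_, ?_, ?_, ?_⟩
  · intro a ha b hab
    obtain ⟨z, hz, hzf, -⟩ := R.exists_pred ⟨(a, b), hab⟩
    exact hout ⟨(a, b), hab⟩ (hzf ▸ ha z hz) (ha _ rfl)
  · rcases hout x hx hx' with h1 | ⟨h1, -⟩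
    · exact Or.inr h1
    · rcases hout x.symm hx' (by simpa using hx) with h2 | ⟨h2, -⟩
      · exact Or.inl h2
      · exact absurd (h2.trans h1.symm) x.fst_ne_snd
  · intro hA
    obtain ⟨⟨d, hd, hdY⟩, -⟩ := PlaneEmbedding.mem_frontier.1 h.fst_mem_frontier
    exact hA d hd hdY
  · intro hA
    obtain ⟨⟨d, hd, hdY⟩, -⟩ := PlaneEmbedding.mem_frontier.1 h.snd_mem_frontier
    exact hA d hd hdY

/-- If every edge has a side in `Y`, then the face to the right of `d₀` can be separated on its
own, hence is the outer face. -/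
theorem compl_singleton (h : R.IsBlocking Y d₀)
    (hint : ∀ x : G.Dart, R.face x ∉ Y → R.face x.symm ∈ Y) :
    R.IsBlocking (Finset.univ.erase (R.face d₀)) d₀ := by
  have hsub : Y ⊆ Finset.univ.erase (R.face d₀) := fun q hq =>
    Finset.mem_erase.2 ⟨fun h' => h.notMem (h' ▸ hq), Finset.mem_univ _⟩
  refine ⟨⟨hsub h.dualConnected.1, ?_⟩, by simp, ?_⟩
  · intro A hA hg hcl
    have hYA : Y ⊆ A := by
      have := h.dualConnected.2 (A ∩ Y) Finset.inter_subset_right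
        (Finset.mem_inter.2 ⟨hg, h.dualConnected.1⟩) fun x _ hxY hxA =>
          Finset.mem_inter.2 ⟨hcl x trivial (hsub hxY) (Finset.mem_inter.1 hxA).1, hxY⟩
      rw [← this]
      exact Finset.inter_subset_left
    refine hA.antisymm fun q hq => ?_
    obtain ⟨x, rfl⟩ := R.exists_face_eq q
    by_cases hx : R.face x ∈ Y
    · exact hYA hx
    · exact hcl x trivial hq (hYA (hint x hx))
  · intro y hy
    obtain ⟨-, h2⟩ := PlaneEmbedding.mem_cut.1 hy
    have h3 : R.face y.symm ∉ Y := fun hmem => h2 (hsub hmem)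
    have h4 := hint _ h3
    rw [SimpleGraph.Dart.symm_symm] at h4
    exact h.one_le y (PlaneEmbedding.mem_cut.2 ⟨h4, h3⟩)

/-- The complement of the right face of `d₀` is blocking too, and a blocking set for a dart with
rotation at most `-4` cannot contain the outer face. -/
theorem isOuterFace (h : R.IsBlocking Y d₀) (hG : G.Preconnected) (hd₀ : R.rotEdge d₀ ≤ -4)
    (hint : ∀ x : G.Dart, R.face x ∉ Y → R.face x.symm ∈ Y) : R.IsOuterFace (R.face d₀) := by
  obtain ⟨d, hd⟩ := R.outer_nonempty ⟨d₀⟩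
  have ho := (R.mem_outer_iff d).1 hd
  by_cases heq : R.face d = R.face d₀
  · exact heq ▸ ho
  · exact absurd ho ((h.compl_singleton hint).not_isOuterFace hG hd₀
      (Finset.mem_erase.2 ⟨heq, Finset.mem_univ _⟩))

theorem neg_two_le (h : R.IsBlocking Y d₀) (hG : G.Preconnected) (hd₀ : R.rotEdge d₀ ≤ -4)
    (hint : ∀ x : G.Dart, R.face x ∉ Y → R.face x.symm ∈ Y) {x : G.Dart}
    (hx : R.face x = R.face d₀) (hne : x ≠ d₀) : -2 ≤ R.rotEdge x := by
  have h1 : x.symm ∈ R.cut Y := PlaneEmbedding.mem_cut.2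
    ⟨hint x (hx ▸ h.notMem), by simpa [hx] using h.notMem⟩
  have h2 := h.le_two hG hd₀ h1 fun h' => hne (SimpleGraph.Dart.symm_involutive.injective h')
  rw [R.rotEdge_symm] at h2
  omega

end IsBlocking

end OrthRep

/-! ### Separation at one vertex contradicts biconnectedness. -/

section separation

variable {W V : Type*}

/-- A walk from `p` that avoids `v` cannot leave `A`. Two vertices outside of `A` are required
because one of them may be `v`. The map `f` allows `K` to be a subgraph on its own vertex type. -/
theorem IsBiconnected.false_of_separation {K : SimpleGraph W} (hK : IsBiconnected K) {f : W → V}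
    (hf : Function.Injective f) {A : Set V} {v : V}
    (hA : ∀ a b, K.Adj a b → f a ∈ A → f b ∈ A ∨ f b = v) {p q q' : W} (hp : f p ∈ A)
    (hq : f q ∉ A) (hq' : f q' ∉ A) (hne : q ≠ q') : False := by
  wlog hqv : f q ≠ v generalizing q q'
  · refine this hq' hq hne.symm fun h => hne (hf ?_)
    rw [not_not.1 hqv, h]
  by_cases hpv : f p = v
  · -- the separating vertex is irrelevant
    obtain ⟨w⟩ := hK.1.preconnected p q
    obtain ⟨d, -, hd1, hd2⟩ := w.exists_boundary_dart {w | f w ∈ A} hp hq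
    rcases hA _ _ d.adj hd1 with h | h
    · exact hd2 h
    · exact hd2 (show f d.snd ∈ A by rw [h, ← hpv]; exact hp)
  by_cases hv : ∃ c, f c = v
  · obtain ⟨c, rfl⟩ := hv
    have hpc : p ∈ ({c}ᶜ : Set W) := fun h => hpv (congrArg f h)
    have hqc : q ∈ ({c}ᶜ : Set W) := fun h => hqv (congrArg f h)
    obtain ⟨w⟩ := not_not.1 (hK.2 c) ⟨p, hpc⟩ ⟨q, hqc⟩
    obtain ⟨d, -, hd1, hd2⟩ := w.exists_boundary_dart {w | f w.1 ∈ A} hp hq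
    rcases hA _ _ d.adj hd1 with h | h
    · exact hd2 h
    · exact d.snd.2 (hf h)
  · obtain ⟨w⟩ := hK.1.preconnected p q
    obtain ⟨d, -, hd1, hd2⟩ := w.exists_boundary_dart {w | f w ∈ A} hp hq
    rcases hA _ _ d.adj hd1 with h | h
    · exact hd2 h
    · exact hv ⟨_, h⟩

end separation

/-! ### Bend bounds for irreducible representations. -/

namespace OrthRep

variable {V : Type*} [Fintype V] [DecidableEq V] {G : SimpleGraph V} [DecidableRel G.Adj]

/-- Make the face to the left of `d₀` the outer face instead of the face to the right of `d₀`. -/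
noncomputable def flipOuter (R : OrthRep G) (d₀ : G.Dart) (ho : R.IsOuterFace (R.face d₀))
    (hne : R.face d₀ ≠ R.face d₀.symm) : OrthRep G :=
  { R with
    outer := Finset.univ.filter fun d => R.face d = R.face d₀.symm
    outer_face := by
      intro d hd d'
      simp only [Finset.mem_filter, Finset.mem_univ, true_and] at hd ⊢
      rw [← R.face_eq_iff, hd]
      exact eq_comm
    outer_nonempty := fun _ => ⟨d₀.symm, by simp⟩
    rotEdge := fun d =>
      R.rotEdge d + 8 * ((if d = d₀ then 1 else 0) - if d = d₀.symm then 1 else 0)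
    rotEdge_symm := by
      intro d
      have e1 : d.symm = d₀ ↔ d = d₀.symm := SimpleGraph.Dart.symm_involutive.eq_iff
      have e2 : d.symm = d₀.symm ↔ d = d₀ :=
        SimpleGraph.Dart.symm_involutive.injective.eq_iff
      simp only [e1, e2, R.rotEdge_symm]
      ring
    rot_face := by
      intro d
      have h := R.rot_face d
      have ho' : d ∈ R.outer ↔ R.face d = R.face d₀ := by
        rw [R.mem_outer_iff]
        exact ⟨fun h' => h'.eq ho, fun h' => h' ▸ ho⟩
      simp only [ho'] at h
      rw [Finset.sum_congr rfl fun d' _ => add_right_comm _ _ _, Finset.sum_add_distrib, h, ← Finset.mul_sum, Finset.sum_sub_distrib]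
      simp only [Finset.sum_ite_eq', Finset.mem_filter, Finset.mem_univ, true_and,
        ← R.face_eq_iff]
      by_cases h1 : R.face d = R.face d₀
      · rw [if_pos h1, if_pos h1, if_neg (h1 ▸ hne), if_neg (h1 ▸ hne)]
        norm_num
      · rw [if_neg h1, if_neg h1]
        split_ifs <;> norm_num }

variable {R : OrthRep G}

/-- At rotation `-5` no slack is left: every frontier vertex has a single outside angle, so a part
hidden outside of `Y` would be disconnected from the rest. Connectedness alone therefore makes the
right face of `d₀` the outer face. -/
theorem IsIrreducible.neg_four_le (hR : R.IsIrreducible) (hG : G.Preconnected) (d₀ : G.Dart) :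
    -4 ≤ R.rotEdge d₀ := by
  by_contra! hlt
  obtain ⟨Y, h⟩ := hR.exists_isBlocking (d₀ := d₀) (by omega)
  have h5 := h.neg_five_le hG (by omega)
  have hint : ∀ x : G.Dart, R.face x ∉ Y → R.face x.symm ∈ Y := by
    intro x hx
    by_contra hx'
    obtain ⟨A, v, hA, hxA, hd, -⟩ := h.exists_separation hG (by omega) hx hx'
    obtain ⟨p, hp⟩ : ∃ p, p ∈ A := hxA.elim (fun h => ⟨_, h⟩) fun h => ⟨_, h⟩
    obtain ⟨w⟩ := hG p d₀.fst
    obtain ⟨d, -, hd1, hd2⟩ := w.exists_boundary_dart A hp hd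
    rcases hA _ hd1 _ d.adj with h' | ⟨-, hfr, h2⟩
    · exact hd2 h'
    · have := h.outAngles_le hG (by omega) hfr
      omega
  have ho := h.isOuterFace hG (by omega) hint
  have hne : R.face d₀ ≠ R.face d₀.symm := fun h' =>
    h.notMem (h' ▸ h.dualConnected.1)
  have hs : d₀.symm ≠ d₀ := SimpleGraph.Dart.symm_ne d₀
  -- Exchanging the required sums `-4` and `4` of the two faces at `d₀` shifts its rotation by `8`,
  -- from `-5` to `3`.
  refine hR (R.flipOuter d₀ ho hne) ⟨fun d => ?_, d₀, by omega, ?_⟩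
  · simp only [flipOuter]
    by_cases e1 : d = d₀
    · subst e1
      simp only [if_true, if_neg hs.symm]
      omega
    · by_cases e2 : d = d₀.symm
      · subst e2
        simp only [if_true, if_neg hs, R.rotEdge_symm]
        omega
      · simp only [if_neg e1, if_neg e2]
        omega
  · simp only [flipOuter, if_true, if_neg hs.symm]
    omega

theorem exists_rotEdge_eq (R : OrthRep G) (e : G.edgeSet) :
    ∃ d : G.Dart, d.edge = e ∧ R.rotEdge d = - (R.bends e : ℤ) := by
  obtain ⟨e, he⟩ := e
  induction e with
  | _ a b =>
    have hb := R.bends_edge ⟨(a, b), he⟩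
    change R.bends ⟨s(a, b), he⟩ = _ at hb
    rw [hb]
    rcases Int.natAbs_eq (R.rotEdge ⟨(a, b), he⟩) with h | h
    · refine ⟨SimpleGraph.Dart.symm ⟨(a, b), he⟩, SimpleGraph.Dart.edge_symm _, ?_⟩
      rw [R.rotEdge_symm]
      omega
    · exact ⟨⟨(a, b), he⟩, rfl, by omega⟩

theorem IsIrreducible.bends_le (hR : R.IsIrreducible) (hG : G.Preconnected) (e : G.edgeSet) :
    R.bends e ≤ 4 := by
  obtain ⟨d, -, hd⟩ := R.exists_rotEdge_eq e
  have := hR.neg_four_le hG d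
  omega

theorem IsIrreducible.threeBendsExceptOuter (hR : R.IsIrreducible) (hG : IsBiconnected G) :
    R.ThreeBendsExceptOuter := by
  have hpre := hG.1.preconnected
  rw [ThreeBendsExceptOuter, or_iff_not_imp_left]
  intro hex
  push Not at hex
  obtain ⟨e₀, he₀⟩ := hex
  -- Two four-bend edges would both have rotation `-4` in the same outer face, where every dart but
  -- one has rotation at least `-2`.
  have key : ∀ d : G.Dart, R.rotEdge d ≤ -4 → R.IsOuterFace (R.face d) ∧
      ∀ x, R.face x = R.face d → x ≠ d → -2 ≤ R.rotEdge x := by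
    intro d hd
    obtain ⟨Y, h⟩ := hR.exists_isBlocking (d₀ := d) (by omega)
    have hint : ∀ x : G.Dart, R.face x ∉ Y → R.face x.symm ∈ Y := by
      intro x hx
      by_contra hx'
      obtain ⟨A, v, hA, hxA, hd1, hd2⟩ := h.exists_separation hpre hd hx hx'
      obtain ⟨p, hp⟩ : ∃ p, p ∈ A := hxA.elim (fun h => ⟨_, h⟩) fun h => ⟨_, h⟩
      exact hG.false_of_separation (f := id) Function.injective_id
        (fun a b hab ha => (hA a ha b hab).imp_right And.left) hp hd1 hd2 d.fst_ne_snd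
    exact ⟨h.isOuterFace hpre hd hint, fun x hx hne => h.neg_two_le hpre hd hint hx hne⟩
  have hle := hR.bends_le hpre
  obtain ⟨d₀, hd₀, hrot⟩ := R.exists_rotEdge_eq e₀
  have h4 := hle e₀
  have h0 := key d₀ (by omega)
  refine ⟨e₀, ⟨d₀, (R.mem_outer_iff d₀).2 h0.1, hd₀⟩, by omega, fun e he => ?_⟩
  by_contra! hlt
  obtain ⟨d, hd, hrot'⟩ := R.exists_rotEdge_eq e
  have h1 := key d (by omega)
  have h2 := h0.2 d (h1.1.eq h0.1) (by
    rintro rfl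
    exact he (Subtype.ext (hd.symm.trans hd₀)))
  omega

namespace IsBlocking

/-- Two edges with four bends in a common biconnected subgraph: both sides of the second one belong
to the part that does not contain the right side of the first one. -/
theorem face_mem_of_isBiconnected {Y : Finset R.Face} {d₀ : G.Dart} (h : R.IsBlocking Y d₀)
    (hG : G.Preconnected) (hd₀ : R.rotEdge d₀ ≤ -4) {B : G.Subgraph} (hB : IsBiconnected B.coe)
    (hd₀B : d₀.edge ∈ B.edgeSet) {d : G.Dart} (hdB : d.edge ∈ B.edgeSet)
    (hd : R.rotEdge d ≤ -4) (hne : d.edge ≠ d₀.edge) :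
    R.face d ∈ Y ∧ R.face d.symm ∈ Y := by
  have hint : R.face d ∈ Y ∨ R.face d.symm ∈ Y := by
    by_contra! hx
    obtain ⟨A, v, hA, hxA, hd1, hd2⟩ := h.exists_separation hG hd₀ hx.1 hx.2
    have hadj : B.Adj d.fst d.snd := hdB
    have hadj₀ : B.Adj d₀.fst d₀.snd := hd₀B
    obtain ⟨p, hp⟩ : ∃ p : B.verts, (p : V) ∈ A :=
      hxA.elim (fun h => ⟨⟨_, hadj.fst_mem⟩, h⟩) fun h => ⟨⟨_, hadj.snd_mem⟩, h⟩
    exact hB.false_of_separation Subtype.val_injective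
      (fun a b hab ha => (hA a ha b (B.adj_sub hab)).imp_right And.left) hp
      (q := ⟨d₀.fst, hadj₀.fst_mem⟩) (q' := ⟨d₀.snd, hadj₀.snd_mem⟩) hd1 hd2
      fun h' => d₀.fst_ne_snd (congrArg Subtype.val h')
  by_contra hnot
  have hcut : d ∈ R.cut Y ∨ d.symm ∈ R.cut Y := by
    rw [PlaneEmbedding.mem_cut, PlaneEmbedding.mem_cut, SimpleGraph.Dart.symm_symm]
    tauto
  rcases hcut with hc | hc
  · have := h.one_le d hc
    omega
  · have := h.le_two hG hd₀ hc fun h' =>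
      hne (by rw [SimpleGraph.Dart.symm_involutive.injective h'])
    rw [R.rotEdge_symm] at this
    omega

end IsBlocking

/-- With two such edges, the blocking set `Y'` of `d'` contains both sides of `d`. The part `U` of
`Y ∩ Y'` reachable from the left of `d` is again blocking for `d`, so it contains both sides of
`d'`; but `Y'` misses the right side of `d'`. -/
theorem IsIrreducible.edge_eq_of_isBiconnected (hR : R.IsIrreducible) (hG : G.Preconnected)
    {B : G.Subgraph} (hB : IsBiconnected B.coe) {d d' : G.Dart} (hdB : d.edge ∈ B.edgeSet)
    (hdB' : d'.edge ∈ B.edgeSet) (hd : R.rotEdge d ≤ -4) (hd' : R.rotEdge d' ≤ -4) :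
    d'.edge = d.edge := by
  by_contra hne
  obtain ⟨Y, h⟩ := hR.exists_isBlocking (d₀ := d) (by omega)
  obtain ⟨Y', h'⟩ := hR.exists_isBlocking (d₀ := d') (by omega)
  have h1 := h'.face_mem_of_isBiconnected hG hd' hB hdB' hdB hd (Ne.symm hne)
  obtain ⟨U, hU, hUc, hUcl⟩ := R.exists_dualConnected Set.univ
    (Finset.mem_inter.2 ⟨h.dualConnected.1, h1.2⟩)
  have hUb : R.IsBlocking U d := by
    refine ⟨hUc, fun hmem => h.notMem (Finset.mem_inter.1 (hU hmem)).1, fun y hy => ?_⟩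
    obtain ⟨hy1, hy2⟩ := PlaneEmbedding.mem_cut.1 hy
    have hy3 := Finset.mem_inter.1 (hU hy1)
    have hy4 : R.face y.symm ∉ Y ∩ Y' := fun hmem =>
      hy2 (hUcl y.symm trivial hmem (by simpa using hy1))
    rw [Finset.mem_inter, not_and_or] at hy4
    rcases hy4 with hy4 | hy4
    · exact h.one_le y (PlaneEmbedding.mem_cut.2 ⟨hy3.1, hy4⟩)
    · exact h'.one_le y (PlaneEmbedding.mem_cut.2 ⟨hy3.2, hy4⟩)
  have h2 := hUb.face_mem_of_isBiconnected hG hd hB hdB hdB' hd' hne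
  exact h'.notMem (Finset.mem_inter.1 (hU h2.1)).2

theorem IsIrreducible.threeBendsPerBlock (hR : R.IsIrreducible) (hG : G.Preconnected) :
    R.ThreeBendsPerBlock := by
  intro B hB
  rw [or_iff_not_imp_left]
  intro hex
  push Not at hex
  obtain ⟨e₀, he₀, hlt⟩ := hex
  have h4 := hR.bends_le hG e₀
  refine ⟨e₀, he₀, by omega, fun e he hne => ?_⟩
  by_contra! hlt'
  obtain ⟨d, hd, hrot⟩ := R.exists_rotEdge_eq e₀
  obtain ⟨d', hd', hrot'⟩ := R.exists_rotEdge_eq e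
  refine hne (Subtype.ext ?_)
  rw [← hd, ← hd']
  exact hR.edge_eq_of_isBiconnected hG hB.prop (by rwa [hd]) (by rwa [hd']) (by omega) (by omega)

/-- Every representation can be replaced by an irreducible one without using more bends, except
that an edge without bends may get one. -/
theorem exists_isIrreducible (R : OrthRep G) :
    ∃ R' : OrthRep G, R'.IsIrreducible ∧ ∀ e, R'.bends e ≤ max 1 (R.bends e) := by
  suffices H : ∃ R' : OrthRep G, R'.IsIrreducible ∧
      ∀ d, (R'.rotEdge d).natAbs ≤ max 1 (R.rotEdge d).natAbs by
    obtain ⟨R', h, hle⟩ := H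
    refine ⟨R', h, fun e => ?_⟩
    obtain ⟨d, hd, -⟩ := R.exists_rotEdge_eq e
    have := hle d
    rw [← R.bends_edge, ← R'.bends_edge] at this
    convert this <;> exact hd.symm
  -- Each improvement lowers this sum: the edge that loses bends had at least two, so the cap at one
  -- does not hide the loss.
  induction hn : ∑ d, max 1 (R.rotEdge d).natAbs using Nat.strong_induction_on generalizing R with
  | _ n ih =>
    by_cases hR : R.IsIrreducible
    · exact ⟨R, hR, fun d => le_max_right _ _⟩
    · rw [IsIrreducible] at hR
      push Not at hR
      obtain ⟨R₁, h1, d, hd, hlt⟩ := hR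
      obtain ⟨R', h, hle⟩ := ih _ (by
        rw [← hn]
        exact Finset.sum_lt_sum (fun d _ => max_le (le_max_left _ _) (h1 d))
          ⟨d, Finset.mem_univ _, by omega⟩) R₁ rfl
      exact ⟨R', h, fun d => (hle d).trans (max_le (le_max_left _ _) (h1 d))⟩

end OrthRep

/-! ### Existence of an orthogonal representation. -/

namespace PlaneEmbedding

variable {V : Type*} [Fintype V] [DecidableEq V] {G : SimpleGraph V} [DecidableRel G.Adj]
variable (P : PlaneEmbedding G)

theorem dualConnected_univ (hG : G.Preconnected) (g : P.Face) :
    P.DualConnected Set.univ Finset.univ g := by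
  refine ⟨Finset.mem_univ _, fun A _ hg hcl => ?_⟩
  replace hcl : ∀ x : G.Dart, P.face x ∈ A → P.face x.symm ∈ A := fun x hx =>
    hcl x.symm trivial (Finset.mem_univ _) (by simpa using hx)
  have hrot : ∀ d d' : G.Dart, d.fst = d'.fst → P.face d ∈ A → P.face d' ∈ A := by
    intro d d' h hd
    by_contra hd'
    obtain ⟨a, -, h1, h2⟩ := P.exists_ccw_change h (p := fun d => P.face d ∈ A) hd hd'
    rw [P.face_ccw] at h2
    exact h2 (hcl a h1)
  obtain ⟨d₀, rfl⟩ := P.exists_face_eq g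
  refine Finset.eq_univ_of_forall fun q => ?_
  obtain ⟨d, rfl⟩ := P.exists_face_eq q
  by_contra hd
  obtain ⟨w⟩ := hG d₀.fst d.fst
  obtain ⟨x, -, ⟨y, hy, hyA⟩, h2⟩ := w.exists_boundary_dart
    {v | ∃ y : G.Dart, y.fst = v ∧ P.face y ∈ A} ⟨d₀, rfl, hg⟩
    (by
      rintro ⟨y, hy, hyA⟩
      exact hd (hrot y d hy hyA))
  exact h2 ⟨x.symm, rfl, hcl x (hrot y x hy hyA)⟩

/-- Prescribed rotations of the edges around the faces can be realized if their sum is zero. -/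
theorem exists_rotEdge (hG : G.Preconnected) (t : P.Face → ℤ) (ht : ∑ q, t q = 0) :
    ∃ ρ : G.Dart → ℤ, (∀ d, ρ d.symm = - ρ d) ∧
      ∀ q, ∑ d : G.Dart with P.face d = q, ρ d = t q := by
  rcases isEmpty_or_nonempty P.Face with hP | ⟨⟨g⟩⟩
  · exact ⟨fun _ => 0, by simp, fun q => hP.elim q⟩
  choose δ h1 _ _ h4 using fun h : P.Face =>
    (P.dualConnected_univ hG g).exists_flow (Finset.mem_univ h)
  refine ⟨fun d => - ∑ h, t h * δ h d, fun d => ?_, fun q => ?_⟩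
  · simp [h1]
  -- Each face `h` receives its demand `t h` from the common face `g`; the contributions at `g`
  -- cancel because the demands sum to zero.
  · rw [Finset.sum_neg_distrib, Finset.sum_comm]
    simp only [← Finset.mul_sum, h4, mul_sub, Finset.sum_sub_distrib, ← Finset.sum_mul, ht]
    simp

theorem exists_rotVertex (hdeg : ∀ v, G.degree v ≤ 4) :
    ∃ r : G.Dart → ℤ,
      (∀ d, r d = 1 ∨ r d = 0 ∨ r d = -1 ∨ (G.degree d.snd = 1 ∧ r d = -2)) ∧
      ∀ v, G.degree v ≠ 0 → ∑ d : G.Dart with d.snd = v, r d = 2 * ((G.degree v : ℤ) - 2) := by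
  have hc : ∀ v, ∃ c : Option G.Dart, G.degree v ≠ 0 → ∃ d, c = some d ∧ d.snd = v := by
    intro v
    by_cases hv : G.degree v = 0
    · exact ⟨none, fun h => absurd hv h⟩
    · rw [← card_darts_snd] at hv
      obtain ⟨d, hd⟩ := Finset.card_pos.1 (Nat.pos_of_ne_zero hv)
      exact ⟨some d, fun _ => ⟨d, rfl, (Finset.mem_filter.1 hd).2⟩⟩
  choose c hc using hc
  -- For degree three, the chosen dart `c d.snd` marks the one straight angle; the other two are
  -- right angles.
  refine ⟨fun d => if G.degree d.snd = 1 then -2 else if G.degree d.snd = 2 then 0 else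
    if G.degree d.snd = 3 ∧ c d.snd = some d then 0 else 1, fun d => ?_, fun v hv => ?_⟩
  · dsimp only
    split_ifs <;> simp_all
  · obtain ⟨x, hx, hxv⟩ := hc v hv
    have hcard := card_darts_snd (G := G) v
    rw [Finset.sum_congr rfl (g := fun d => if G.degree v = 1 then (-2 : ℤ) else
      if G.degree v = 2 then 0 else if G.degree v = 3 then 1 - (if d = x then 1 else 0) else 1)]
    · have h4 := hdeg v
      have : G.degree v = 1 ∨ G.degree v = 2 ∨ G.degree v = 3 ∨ G.degree v = 4 := by omega
      rcases this with h | h | h | h <;> simp [h, hcard, hxv]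
    · intro d hd
      dsimp only
      rw [(Finset.mem_filter.1 hd).2, hx]
      by_cases h : d = x
      · subst h; simp
      · simp [h, Ne.symm h]

/-- Once the angles are fixed, the edges must supply what each face still lacks. These demands sum
to `4F - 8 - (4E - 4V)`, which is zero by Euler's formula. -/
theorem exists_orthRep (P : PlaneEmbedding G) (hG : G.Preconnected) (hdeg : ∀ v, G.degree v ≤ 4) :
    Nonempty (OrthRep G) := by
  classical
  obtain ⟨r, hr, hrv⟩ := exists_rotVertex hdeg
  have hsum : ∑ q, ((if P.IsOuterFace q then (-4 : ℤ) else 4) -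
      ∑ d : G.Dart with P.face d = q, r d) = 0 := by
    rcases isEmpty_or_nonempty G.Dart with hD | ⟨⟨x⟩⟩
    · have : IsEmpty P.Face := ⟨fun q => hD.elim (P.exists_face_eq q).choose⟩
      simp
    have : Nontrivial V := ⟨x.fst, x.snd, x.fst_ne_snd⟩
    rw [Finset.sum_sub_distrib, P.sum_faceRotation, P.sum_faces, if_pos]
    · have h1 := sum_darts_at_vertices (fun _ : G.Dart => True) r
      simp only [and_true] at h1
      rw [Finset.sum_congr rfl fun v _ => hrv v (hG.degree_pos_of_nontrivial v).ne',
        ← Finset.mul_sum, Finset.sum_sub_distrib, ← Nat.cast_sum,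
        G.sum_degrees_eq_twice_card_edges] at h1
      have h2 := P.euler
      have h3 : Nat.card (Quotient (Equiv.Perm.SameCycle.setoid (facePerm P.ccw))) =
        Fintype.card P.Face := Nat.card_eq_fintype_card (α := P.Face)
      have h4 : 0 < Fintype.card P.Face := Fintype.card_pos_iff.2 ⟨P.face x⟩
      simp only [Finset.mem_univ, Finset.card_univ, Finset.sum_const, nsmul_eq_mul] at h1 ⊢
      rw [← h1]
      push_cast
      omega
    · obtain ⟨d, hd⟩ := P.outer_nonempty ⟨x⟩
      exact ⟨_, Finset.mem_univ _, (P.mem_outer_iff d).1 hd⟩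
  obtain ⟨ρ, hρ, hρf⟩ := P.exists_rotEdge hG _ hsum
  exact ⟨{ P with
    rotEdge := ρ
    rotVertex := r
    rotVertex_range := hr
    rotEdge_symm := hρ
    rot_around_vertex := hrv
    rot_face := by
      intro d
      have h := hρf (P.face d)
      have hs : (Finset.univ.filter fun d' => (facePerm P.ccw).SameCycle d d') =
          Finset.univ.filter fun d' => P.face d' = P.face d := by
        ext d'
        simp only [Finset.mem_filter, Finset.mem_univ, true_and, ← P.face_eq_iff]
        exact eq_comm
      simp only [P.mem_outer_iff]
      rw [hs, Finset.sum_add_distrib, h]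
      ring }⟩

end PlaneEmbedding

/-! ### Costs, optimality and validity. -/

theorem map_one_eq_of_one_le_costFlexibility {c : ℕ → WithTop ℝ} (hc : Monotone c)
    (h : 1 ≤ costFlexibility c) : c 1 = c 0 := by
  refine le_antisymm ?_ (hc zero_le_one)
  by_contra hlt
  have : costFlexibility c ≤ 0 := by
    refine iSup_le fun ⟨ρ, hρ⟩ => ?_
    rcases Nat.eq_zero_or_pos ρ with rfl | hpos
    · simp
    · exact absurd ((hc hpos).trans hρ.le) hlt
  exact absurd (h.trans this) (by simp)

namespace OrthRep

variable {V : Type*} [Fintype V] [DecidableEq V] {G : SimpleGraph V} [DecidableRel G.Adj]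

theorem totalCost_mono {cost : G.edgeSet → ℕ → WithTop ℝ} (hcost : IsConvexInstance cost)
    {R R' : OrthRep G} (h : ∀ e, R'.bends e ≤ max 1 (R.bends e)) :
    R'.totalCost cost ≤ R.totalCost cost := by
  refine Finset.sum_le_sum fun e _ => ?_
  obtain ⟨hmono, hflex, -⟩ := hcost e
  refine (hmono (h e)).trans ?_
  rcases Nat.eq_zero_or_pos (R.bends e) with h0 | hpos
  · rw [h0, max_eq_left zero_le_one, map_one_eq_of_one_le_costFlexibility hmono hflex]
  · rw [max_eq_right hpos]

/-- Bend vectors of irreducible representations are bounded by `4`, so the minimum over them is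
attained. It is a global minimum because every representation reduces to an irreducible one of no
greater cost. -/
theorem exists_isOptimal_isIrreducible (hG : G.Preconnected) (hR : Nonempty (OrthRep G))
    {cost : G.edgeSet → ℕ → WithTop ℝ} (hcost : IsConvexInstance cost) :
    ∃ R : OrthRep G, R.IsOptimal cost ∧ R.IsIrreducible := by
  have hfin : {β : G.edgeSet → ℕ | ∃ R : OrthRep G, R.IsIrreducible ∧ R.bends = β}.Finite := by
    refine (Set.finite_Iic fun _ => 4).subset ?_
    rintro _ ⟨R, hR, rfl⟩ e
    exact hR.bends_le hG e
  obtain ⟨R₀⟩ := hR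
  obtain ⟨R₁, hR₁, -⟩ := R₀.exists_isIrreducible
  obtain ⟨_, ⟨R, hR, rfl⟩, hmin⟩ := Set.exists_min_image _
    (fun β : G.edgeSet → ℕ => ∑ e, cost e (β e)) hfin ⟨_, R₁, hR₁, rfl⟩
  refine ⟨R, fun R' => ?_, hR⟩
  obtain ⟨R'', hR'', hle⟩ := R'.exists_isIrreducible
  exact (hmin _ ⟨R'', hR'', rfl⟩).trans (totalCost_mono hcost hle)

theorem IsValid.of_bends_le {flex : G.edgeSet → ℕ∞} (hflex : ∀ e, 1 ≤ flex e) {R R' : OrthRep G}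
    (hR : R.IsValid flex) (h : ∀ e, R'.bends e ≤ max 1 (R.bends e)) : R'.IsValid flex := by
  intro e
  rcases le_max_iff.1 (h e) with h1 | h1
  · exact (Nat.cast_le.2 h1).trans (by simpa using hflex e)
  · exact (Nat.cast_le.2 h1).trans (hR e)

end OrthRep

theorem mainTheorem3 {V : Type*} [Fintype V] [DecidableEq V] (G : SimpleGraph V)
    [DecidableRel G.Adj] (hG : IsFourPlanar G) :
    -- flexibilities, biconnected graphs
    (IsBiconnected G → ∀ flex : G.edgeSet → ℕ∞, (∀ e, 1 ≤ flex e) →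
      (∃ R : OrthRep G, R.IsValid flex) →
        ∃ R : OrthRep G, R.IsValid flex ∧ R.ThreeBendsExceptOuter) ∧
    -- convex costs, biconnected graphs
    (IsBiconnected G → ∀ cost : G.edgeSet → ℕ → WithTop ℝ, IsConvexInstance cost →
      ∃ R : OrthRep G, R.IsOptimal cost ∧ R.ThreeBendsExceptOuter) ∧
    -- convex costs, connected graphs
    (G.Connected → ∀ cost : G.edgeSet → ℕ → WithTop ℝ, IsConvexInstance cost →
      ∃ R : OrthRep G, R.IsOptimal cost ∧ R.ThreeBendsPerBlock) := by
  obtain ⟨⟨P⟩, hdeg⟩ := hG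
  refine ⟨fun hB flex hflex hR => ?_, fun hB cost hcost => ?_, fun hC cost hcost => ?_⟩
  · obtain ⟨R, hR⟩ := hR
    obtain ⟨R', hR', hle⟩ := R.exists_isIrreducible
    exact ⟨R', hR.of_bends_le hflex hle, hR'.threeBendsExceptOuter hB⟩
  · have hC := hB.1.preconnected
    obtain ⟨R, hopt, hR⟩ := OrthRep.exists_isOptimal_isIrreducible hC
      (P.exists_orthRep hC hdeg) hcost
    exact ⟨R, hopt, hR.threeBendsExceptOuter hB⟩
  · have hC := hC.preconnected
    obtain ⟨R, hopt, hR⟩ := OrthRep.exists_isOptimal_isIrreducible hC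
      (P.exists_orthRep hC hdeg) hcost
    exact ⟨R, hopt, hR.threeBendsPerBlock hC⟩
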